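/- Let $G$ be a finite compact metric graph (loops, multiple edges and several components are allowed): finitely many edges $I_j=[0,L_j]$, $L_j>0$, $j=1,\dots,r$, whose endpoints are partitioned into nonempty classes, the vertices $v_1,\dots,v_s$; $o(I_j)$ and $t(I_j)$ denote the vertices containing the endpoints $0$ and $L_j$ of $I_j$. Let $q_j\in L^1(I_j)$ be real-valued and $(\mathcal L f)_j=-f_j''+q_jf_j$. Let $AC^2(G)$ be the set of all $f=(f_j)$ such that $f_j$ and $f_j'$ are absolutely continuous on $I_j$; call $f$ continuous on $G$ if every $f_j$ is continuous and the values at all endpoints belonging to the same vertex $v$ coincide (this value is $f(v)$); and put $\partial_\nu f(v)=\sum_{t(I_j)=v}f_j'(L_j)-\sum_{o(I_j)=v}f_j'(0)$. For $\alpha\in\mathbb R^s$ let $A_\alpha f=\mathcal L f$ be the operator in $L^2(G)=\bigoplus_jL^2(I_j)$ whose domain consists of all $f\in L^2(G)\cap AC^2(G)$ that are continuous on $G$ and satisfy $\mathcal L f\in L^2(G)$ and $\partial_\nu f(v_i)=\alpha_if(v_i)$, $i=1,\dots,s$. Let $B=\{v_{i_1},\dots,v_{i_m}\}$ be a nonempty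 set of vertices. For $\mu\in\mathbb C\setminus\sigma(A_\alpha)$ and $l=1,\dots,m$ there is exactly one $f^{(l)}\in L^2(G)\cap AC^2(G)$, continuous on $G$, with $\mathcal L f^{(l)}=\mu f^{(l)}$, $\partial_\nu f^{(l)}(v_{i_l})-\alpha_{i_l}f^{(l)}(v_{i_l})=1$ and $\partial_\nu f^{(l)}(v_i)-\alpha_if^{(l)}(v_i)=0$ for all $i\ne i_l$; the Titchmarsh--Weyl matrix $M_{B,\alpha}(\mu)\in\mathbb C^{m\times m}$ is defined by $(M_{B,\alpha}(\mu))_{k,l}=f^{(l)}(v_{i_k})$. Then $\mu\mapsto M_{B,\alpha}(\mu)$ is analytic on $\mathbb C\setminus\sigma(A_\alpha)$; the points of $\sigma(A_\alpha)$ are isolated, and each non-removable singularity of $M_{B,\alpha}$ is a pole of order one. Moreover, for each $\lambda\in\mathbb R$ the residue $\operatorname{Res}_\lambda M_{B,\alpha}=\frac1{2\pi i}\oint M_{B,\alpha}(\mu)\,d\mu$ (over all sufficiently small circles around $\lambda$; it is $0$ if $M_{B,\alpha}$ is analytic at $\lambda$ or can be continued analytically into $\lambda$) and the linear map $$\gamma_\lambda:\ker(A_\alpha-\lambda)\to\mathbb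 C^m,\qquad f\mapsto(f(v_{i_1}),\dots,f(v_{i_m}))^{\top},$$ satisfy $\operatorname{ran}\gamma_\lambda=\operatorname{ran}\operatorname{Res}_\lambda M_{B,\alpha}$. In particular, $\ker(A_\alpha-\lambda)$ is finite-dimensional and $$\dim\ker(A_\alpha-\lambda)=\operatorname{rank}\operatorname{Res}_\lambda M_{B,\alpha}+\dim\ker\gamma_\lambda .$$ -/

import Mathlib

open MeasureTheory Set Filter Topology
open scoped Matrix.Norms.Elementwise

noncomputable section

/-! ### Resolvent set and spectrum of an unbounded operator -/

/-- The resolvent set of an (unbounded) operator `T` in a complex normed space: all `μ` for which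
`T - μ : dom T → H` is bijective with an everywhere defined bounded inverse `R`. -/
def LinearPMap.resolventSet {H : Type*} [NormedAddCommGroup H] [NormedSpace ℂ H]
    (T : H →ₗ.[ℂ] H) : Set ℂ :=
  {μ | ∃ R : H →L[ℂ] H,
    (∀ g : H, ∃ h : R g ∈ T.domain, T ⟨R g, h⟩ - μ • R g = g) ∧
    (∀ f : T.domain, R (T f - μ • (f : H)) = (f : H))}

/-- The spectrum of an (unbounded) operator: the complement of the resolvent set. -/
def LinearPMap.spectrum {H : Type*} [NormedAddCommGroup H] [NormedSpace ℂ H]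
    (T : H →ₗ.[ℂ] H) : Set ℂ :=
  T.resolventSetᶜ

/-- `ker (T - μ)`, as a subspace of the domain of `T`. -/
def LinearPMap.eigenKer {H : Type*} [NormedAddCommGroup H] [NormedSpace ℂ H]
    (T : H →ₗ.[ℂ] H) (μ : ℂ) : Submodule ℂ T.domain :=
  LinearMap.ker (T.toFun - μ • T.domain.subtype)

/-! ### Singularities and residues of functions of a complex variable -/

/-- `M` can be continued analytically into `z`; the value of `M` at `z` itself plays no role. -/
def IsRemovableSingularityAt {F : Type*} [NormedAddCommGroup F] [NormedSpace ℂ F]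
    (M : ℂ → F) (z : ℂ) : Prop :=
  ∃ N : ℂ → F, AnalyticAt ℂ N z ∧ M =ᶠ[𝓝[≠] z] N

/-- `M` has a pole of order one at `z`. -/
def IsSimplePoleAt {F : Type*} [NormedAddCommGroup F] [NormedSpace ℂ F]
    (M : ℂ → F) (z : ℂ) : Prop :=
  MeromorphicAt M z ∧ meromorphicOrderAt M z = -1

/-- `M` has residue `R` at `z`: `(2πi)⁻¹ ∮ M = R` over every sufficiently small circle
around `z`. -/
def HasResidueAt {F : Type*} [NormedAddCommGroup F] [NormedSpace ℂ F]
    (M : ℂ → F) (z : ℂ) (R : F) : Prop :=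
  ∀ᶠ r : ℝ in 𝓝[>] 0, CircleIntegrable M z r ∧
    (2 * (Real.pi : ℂ) * Complex.I)⁻¹ • (∮ w in C(z, r), M w) = R

/-! ### Metric graphs -/

/-- A finite compact metric graph: finitely many edges `[0, L_e]`, whose endpoints are
glued together to vertices. The endpoint `0` of `e` belongs to the vertex `origin e`, the
endpoint `L_e` to the vertex `terminus e`; a vertex is thus the (nonempty) class of endpoints
that are sent to it. Loops and multiple edges are allowed; the graph need not be connected. -/
structure MetricGraph (V E : Type*) where
  length : E → ℝ
  length_pos : ∀ e, 0 < length e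
  origin : E → V
  terminus : E → V
  endpoint_surj : ∀ v, (∃ e, origin e = v) ∨ ∃ e, terminus e = v

namespace MetricGraph

variable {V E : Type*} (G : MetricGraph V E)

/-- The edge `e`, as an interval. -/
def edge (e : E) : Set ℝ := Icc 0 (G.length e)

/-- The Hilbert space `L²(G) = ⨁ₑ L²(0, L_e)`. -/
abbrev L2 [Fintype E] : Type _ :=
  PiLp 2 (fun e : E => Lp ℂ 2 ((volume : Measure ℝ).restrict (G.edge e)))

/-! A function on `G` is a family of functions `f e`, of which only the values on
`G.edge e` matter. -/

/-- The derivative `f_e'` on the compact interval `[0, L_e]` (one-sided at the endpoints). -/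
def deriv (f : E → ℝ → ℂ) (e : E) : ℝ → ℂ := derivWithin (f e) (G.edge e)

/-- The second derivative `f_e''`. -/
def deriv2 (f : E → ℝ → ℂ) (e : E) : ℝ → ℂ := derivWithin (G.deriv f e) (G.edge e)

/-- The class `AC²(G)`: each `f_e` is differentiable on `[0, L_e]`, and `f_e`, `f_e'` are
absolutely continuous. -/
def IsAC2 (f : E → ℝ → ℂ) : Prop :=
  ∀ e, DifferentiableOn ℝ (f e) (G.edge e) ∧
    AbsolutelyContinuousOnInterval (f e) 0 (G.length e) ∧
    AbsolutelyContinuousOnInterval (G.deriv f e) 0 (G.length e)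

/-- Continuity of a function on `G`: continuity on each edge, and equal values at any two
endpoints that are glued together. -/
structure IsContinuous (f : E → ℝ → ℂ) : Prop where
  continuousOn : ∀ e, ContinuousOn (f e) (G.edge e)
  origin_origin : ∀ e e', G.origin e = G.origin e' → f e 0 = f e' 0
  origin_terminus : ∀ e e', G.origin e = G.terminus e' → f e 0 = f e' (G.length e')
  terminus_terminus : ∀ e e', G.terminus e = G.terminus e' →
    f e (G.length e) = f e' (G.length e')

open Classical in
/-- The value `f(v)` of an arbitrary component of `f` at `v` (for `f` continuous on `G`). -/
def vertexValue (f : E → ℝ → ℂ) (v : V) : ℂ :=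
  if h : ∃ e, G.origin e = v then f h.choose 0
  else if h : ∃ e, G.terminus e = v then f h.choose (G.length h.choose)
  else 0

open Classical in
/-- `∂_ν f(v) = ∑_{t(e) = v} f_e'(L_e) - ∑_{o(e) = v} f_e'(0)`. -/
def normalDeriv [Fintype E] (f : E → ℝ → ℂ) (v : V) : ℂ :=
  (∑ e with G.terminus e = v, G.deriv f e (G.length e)) -
    ∑ e with G.origin e = v, G.deriv f e 0

/-- The boundary expression `∂_ν f(v) - α_v f(v)`. -/
def deltaData [Fintype E] (α : V → ℝ) (f : E → ℝ → ℂ) (v : V) : ℂ :=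
  G.normalDeriv f v - (α v : ℂ) * G.vertexValue f v

/-- The Schrödinger differential expression `(𝓛 f)_e = -f_e'' + q_e f_e`. -/
def schrodinger (q : E → ℝ → ℝ) (f : E → ℝ → ℂ) (e : E) : ℝ → ℂ :=
  fun x => -G.deriv2 f e x + (q e x : ℂ) * f e x

/-- Functions in the domain of `A_α`. (Square integrability of `f` itself is automatic, since
`f` is continuous on the compact edges.) -/
structure IsDomainFun [Fintype E] (q : E → ℝ → ℝ) (α : V → ℝ) (f : E → ℝ → ℂ) : Prop where
  ac2 : G.IsAC2 f
  continuous : G.IsContinuous f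
  memLp : ∀ e, MemLp (G.schrodinger q f e) 2 ((volume : Measure ℝ).restrict (G.edge e))
  delta : ∀ v, G.deltaData α f v = 0

/-- `f` is a representative of `u ∈ L²(G)`. -/
def IsRep [Fintype E] (u : G.L2) (f : E → ℝ → ℂ) : Prop :=
  ∀ e, (u e : ℝ → ℂ) =ᵐ[(volume : Measure ℝ).restrict (G.edge e)] f e

/-! #### Linearity of the pieces -/

section Linearity

variable {G}

lemma uniqueDiffOn_edge (e : E) : UniqueDiffOn ℝ (G.edge e) :=
  uniqueDiffOn_Icc (G.length_pos e)

lemma zero_mem_edge (e : E) : (0 : ℝ) ∈ G.edge e := ⟨le_rfl, (G.length_pos e).le⟩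

lemma length_mem_edge (e : E) : G.length e ∈ G.edge e := ⟨(G.length_pos e).le, le_rfl⟩

lemma uIcc_eq_edge (e : E) : uIcc 0 (G.length e) = G.edge e := uIcc_of_le (G.length_pos e).le

lemma _root_.AbsolutelyContinuousOnInterval.congr_edge {f g : ℝ → ℂ} {a b : ℝ}
    (hf : AbsolutelyContinuousOnInterval f a b) (h : EqOn f g (uIcc a b)) :
    AbsolutelyContinuousOnInterval g a b := by
  rw [absolutelyContinuousOnInterval_iff] at hf ⊢
  intro ε hε
  obtain ⟨δ, hδ, H⟩ := hf ε hε
  refine ⟨δ, hδ, fun I hI hs => ?_⟩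
  have := H I hI hs
  rwa [Finset.sum_congr rfl fun i hi => by rw [h (hI.1 i hi).1, h (hI.1 i hi).2]] at this

lemma deriv_congr {f g : E → ℝ → ℂ} (h : ∀ e, EqOn (f e) (g e) (G.edge e)) (e : E) :
    EqOn (G.deriv f e) (G.deriv g e) (G.edge e) :=
  fun _ hx => derivWithin_congr (h e) (h e hx)

lemma schrodinger_congr {f g : E → ℝ → ℂ} (h : ∀ e, EqOn (f e) (g e) (G.edge e))
    (q : E → ℝ → ℝ) (e : E) :
    EqOn (G.schrodinger q f e) (G.schrodinger q g e) (G.edge e) := by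
  intro x hx
  have h2 : G.deriv2 f e x = G.deriv2 g e x :=
    derivWithin_congr (deriv_congr h e) (deriv_congr h e hx)
  simp only [schrodinger, h2, h e hx]

lemma vertexValue_congr {f g : E → ℝ → ℂ} (h : ∀ e, EqOn (f e) (g e) (G.edge e)) (v : V) :
    G.vertexValue f v = G.vertexValue g v := by
  unfold vertexValue
  split_ifs with h1 h2
  · exact h _ (zero_mem_edge _)
  · exact h _ (length_mem_edge _)
  · rfl

lemma vertexValue_add (f g : E → ℝ → ℂ) (v : V) :
    G.vertexValue (f + g) v = G.vertexValue f v + G.vertexValue g v := by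
  unfold vertexValue
  split_ifs <;> simp

lemma vertexValue_smul (c : ℂ) (f : E → ℝ → ℂ) (v : V) :
    G.vertexValue (c • f) v = c * G.vertexValue f v := by
  unfold vertexValue
  split_ifs <;> simp

lemma deriv_add {f g : E → ℝ → ℂ} (hf : G.IsAC2 f) (hg : G.IsAC2 g) (e : E) :
    EqOn (G.deriv (f + g) e) (G.deriv f e + G.deriv g e) (G.edge e) :=
  fun x hx => derivWithin_add ((hf e).1 x hx) ((hg e).1 x hx)

lemma deriv_smul (c : ℂ) {f : E → ℝ → ℂ} (hf : G.IsAC2 f) (e : E) :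
    EqOn (G.deriv (c • f) e) (c • G.deriv f e) (G.edge e) :=
  fun x hx => derivWithin_const_smul c ((hf e).1 x hx)

lemma IsAC2.add {f g : E → ℝ → ℂ} (hf : G.IsAC2 f) (hg : G.IsAC2 g) : G.IsAC2 (f + g) :=
  fun e => ⟨(hf e).1.add (hg e).1, (hf e).2.1.add (hg e).2.1,
    ((hf e).2.2.add (hg e).2.2).congr_edge
      (by rw [uIcc_eq_edge]; exact (deriv_add hf hg e).symm)⟩

lemma IsAC2.smul (c : ℂ) {f : E → ℝ → ℂ} (hf : G.IsAC2 f) : G.IsAC2 (c • f) :=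
  fun e => ⟨(hf e).1.const_smul c, (hf e).2.1.const_smul c,
    ((hf e).2.2.const_smul c).congr_edge
      (by rw [uIcc_eq_edge]; exact (deriv_smul c hf e).symm)⟩

lemma IsAC2.ae_differentiable {f : E → ℝ → ℂ} (hf : G.IsAC2 f) (e : E) :
    ∀ᵐ x ∂(volume : Measure ℝ).restrict (G.edge e),
      DifferentiableWithinAt ℝ (G.deriv f e) (G.edge e) x := by
  have h := (hf e).2.2.boundedVariationOn
  rw [uIcc_eq_edge] at h
  exact h.locallyBoundedVariationOn.ae_differentiableWithinAt measurableSet_Icc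

lemma schrodinger_add (q : E → ℝ → ℝ) {f g : E → ℝ → ℂ} (hf : G.IsAC2 f) (hg : G.IsAC2 g)
    (e : E) : G.schrodinger q (f + g) e =ᵐ[(volume : Measure ℝ).restrict (G.edge e)]
      G.schrodinger q f e + G.schrodinger q g e := by
  filter_upwards [hf.ae_differentiable e, hg.ae_differentiable e,
    ae_restrict_mem (measurableSet_Icc : MeasurableSet (G.edge e))] with x h1 h2 hx
  have h3 : G.deriv2 (f + g) e x = G.deriv2 f e x + G.deriv2 g e x :=
    (derivWithin_congr (deriv_add hf hg e) (deriv_add hf hg e hx)).trans (derivWithin_add h1 h2)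
  simp only [schrodinger, Pi.add_apply, h3]
  ring

lemma schrodinger_smul (q : E → ℝ → ℝ) (c : ℂ) {f : E → ℝ → ℂ} (hf : G.IsAC2 f) (e : E) :
    G.schrodinger q (c • f) e =ᵐ[(volume : Measure ℝ).restrict (G.edge e)]
      c • G.schrodinger q f e := by
  filter_upwards [hf.ae_differentiable e,
    ae_restrict_mem (measurableSet_Icc : MeasurableSet (G.edge e))] with x h1 hx
  have h3 : G.deriv2 (c • f) e x = c • G.deriv2 f e x :=
    (derivWithin_congr (deriv_smul c hf e) (deriv_smul c hf e hx)).trans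
      (derivWithin_const_smul c h1)
  simp only [schrodinger, Pi.smul_apply, h3, smul_eq_mul]
  ring

lemma IsContinuous.add {f g : E → ℝ → ℂ} (hf : G.IsContinuous f) (hg : G.IsContinuous g) :
    G.IsContinuous (f + g) where
  continuousOn e := (hf.continuousOn e).add (hg.continuousOn e)
  origin_origin e e' h := congrArg₂ (· + ·) (hf.origin_origin e e' h) (hg.origin_origin e e' h)
  origin_terminus e e' h :=
    congrArg₂ (· + ·) (hf.origin_terminus e e' h) (hg.origin_terminus e e' h)
  terminus_terminus e e' h :=
    congrArg₂ (· + ·) (hf.terminus_terminus e e' h) (hg.terminus_terminus e e' h)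

lemma IsContinuous.smul (c : ℂ) {f : E → ℝ → ℂ} (hf : G.IsContinuous f) :
    G.IsContinuous (c • f) where
  continuousOn e := (hf.continuousOn e).const_smul c
  origin_origin e e' h := congrArg (c • ·) (hf.origin_origin e e' h)
  origin_terminus e e' h := congrArg (c • ·) (hf.origin_terminus e e' h)
  terminus_terminus e e' h := congrArg (c • ·) (hf.terminus_terminus e e' h)

variable [Fintype E]

lemma deltaData_add (α : V → ℝ) {f g : E → ℝ → ℂ} (hf : G.IsAC2 f) (hg : G.IsAC2 g) (v : V) :
    G.deltaData α (f + g) v = G.deltaData α f v + G.deltaData α g v := by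
  simp only [deltaData, normalDeriv, vertexValue_add, deriv_add hf hg _ (zero_mem_edge _),
    deriv_add hf hg _ (length_mem_edge _), Pi.add_apply, Finset.sum_add_distrib]
  ring

lemma deltaData_smul (α : V → ℝ) (c : ℂ) {f : E → ℝ → ℂ} (hf : G.IsAC2 f) (v : V) :
    G.deltaData α (c • f) v = c * G.deltaData α f v := by
  simp only [deltaData, normalDeriv, vertexValue_smul, deriv_smul c hf _ (zero_mem_edge _),
    deriv_smul c hf _ (length_mem_edge _), Pi.smul_apply, smul_eq_mul, ← Finset.mul_sum]
  ring

lemma IsDomainFun.add {q : E → ℝ → ℝ} {α : V → ℝ} {f g : E → ℝ → ℂ}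
    (hf : G.IsDomainFun q α f) (hg : G.IsDomainFun q α g) : G.IsDomainFun q α (f + g) where
  ac2 := hf.ac2.add hg.ac2
  continuous := hf.continuous.add hg.continuous
  memLp e := ((hf.memLp e).add (hg.memLp e)).ae_eq (schrodinger_add q hf.ac2 hg.ac2 e).symm
  delta v := by rw [deltaData_add α hf.ac2 hg.ac2, hf.delta, hg.delta, add_zero]

lemma IsDomainFun.smul {q : E → ℝ → ℝ} {α : V → ℝ} (c : ℂ) {f : E → ℝ → ℂ}
    (hf : G.IsDomainFun q α f) : G.IsDomainFun q α (c • f) where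
  ac2 := hf.ac2.smul c
  continuous := hf.continuous.smul c
  memLp e := ((hf.memLp e).const_smul c).ae_eq (schrodinger_smul q c hf.ac2 e).symm
  delta v := by rw [deltaData_smul α c hf.ac2, hf.delta, mul_zero]

lemma isDomainFun_zero (q : E → ℝ → ℝ) (α : V → ℝ) : G.IsDomainFun q α 0 := by
  have h1 : ∀ e, G.deriv 0 e = 0 := fun e => by
    funext x
    exact congrFun (derivWithin_const (G.edge e) (0 : ℂ)) x
  have h2 : ∀ e, G.deriv2 0 e = 0 := fun e => by
    funext x
    simp only [deriv2, h1]
    exact congrFun (derivWithin_const (G.edge e) (0 : ℂ)) x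
  have h0 : ∀ a b : ℝ, AbsolutelyContinuousOnInterval (0 : ℝ → ℂ) a b := fun a b => by
    exact
      ((LipschitzWith.const (0 : ℂ)).lipschitzOnWith (s := uIcc a b)).absolutelyContinuousOnInterval
  refine ⟨fun e => ⟨differentiableOn_const 0, h0 _ _, by rw [h1]; exact h0 _ _⟩,
    ⟨fun e => continuousOn_const, fun _ _ _ => rfl, fun _ _ _ => rfl, fun _ _ _ => rfl⟩,
    fun e => ?_, fun v => ?_⟩
  · have : G.schrodinger q 0 e = 0 := by
      funext x
      simp [schrodinger, h2]
    rw [this]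
    exact MemLp.zero
  · simp [deltaData, normalDeriv, vertexValue, h1]

lemma IsRep.add {u w : G.L2} {f g : E → ℝ → ℂ} (hf : G.IsRep u f) (hg : G.IsRep w g) :
    G.IsRep (u + w) (f + g) := fun e => by
  filter_upwards [hf e, hg e, Lp.coeFn_add (u e) (w e)] with x h1 h2 h3
  simp only [PiLp.add_apply, Pi.add_apply] at h3 ⊢
  rw [h3, h1, h2]

lemma IsRep.smul (c : ℂ) {u : G.L2} {f : E → ℝ → ℂ} (hf : G.IsRep u f) :
    G.IsRep (c • u) (c • f) := fun e => by
  filter_upwards [hf e, Lp.coeFn_smul c (u e)] with x h1 h3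
  simp only [PiLp.smul_apply, Pi.smul_apply] at h3 ⊢
  rw [h3, h1]

lemma isRep_zero : G.IsRep (0 : G.L2) 0 := fun e => by
  filter_upwards [Lp.coeFn_zero ℂ 2 ((volume : Measure ℝ).restrict (G.edge e))] with x h
  simpa using h

/-- The continuous representative is unique. -/
lemma IsRep.eqOn {u : G.L2} {f g : E → ℝ → ℂ} (hf : G.IsRep u f) (hg : G.IsRep u g)
    (hfc : G.IsContinuous f) (hgc : G.IsContinuous g) (e : E) :
    EqOn (f e) (g e) (G.edge e) :=
  Measure.eqOn_Icc_of_ae_eq volume (G.length_pos e).ne ((hf e).symm.trans (hg e))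
    (hfc.continuousOn e) (hgc.continuousOn e)

end Linearity

/-! ### The operator `A_α` -/

variable [Fintype E] (q : E → ℝ → ℝ) (α : V → ℝ)

/-- `dom A_α`, as a subspace of `L²(G)`. -/
def domain : Submodule ℂ G.L2 where
  carrier := {u | ∃ f, G.IsRep u f ∧ G.IsDomainFun q α f}
  add_mem' := by
    rintro u w ⟨f, hf, hf'⟩ ⟨g, hg, hg'⟩
    exact ⟨f + g, hf.add hg, hf'.add hg'⟩
  zero_mem' := ⟨0, isRep_zero, isDomainFun_zero q α⟩
  smul_mem' := by
    rintro c u ⟨f, hf, hf'⟩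
    exact ⟨c • f, hf.smul c, hf'.smul c⟩

variable {q α}

/-- The continuous representative of an element of `dom A_α` (unique on the edges). -/
def rep (u : G.domain q α) : E → ℝ → ℂ := u.2.choose

lemma isRep_rep (u : G.domain q α) : G.IsRep u (G.rep u) := u.2.choose_spec.1

lemma isDomainFun_rep (u : G.domain q α) : G.IsDomainFun q α (G.rep u) := u.2.choose_spec.2

lemma rep_eqOn {u : G.domain q α} {f : E → ℝ → ℂ} (hf : G.IsRep u f)
    (hf' : G.IsContinuous f) (e : E) : EqOn (G.rep u e) (f e) (G.edge e) :=
  (G.isRep_rep u).eqOn hf (G.isDomainFun_rep u).continuous hf' e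

lemma rep_add (u w : G.domain q α) (e : E) :
    EqOn (G.rep (u + w) e) ((G.rep u + G.rep w) e) (G.edge e) :=
  G.rep_eqOn ((G.isRep_rep u).add (G.isRep_rep w))
    ((G.isDomainFun_rep u).continuous.add (G.isDomainFun_rep w).continuous) e

lemma rep_smul (c : ℂ) (u : G.domain q α) (e : E) :
    EqOn (G.rep (c • u) e) ((c • G.rep u) e) (G.edge e) :=
  G.rep_eqOn ((G.isRep_rep u).smul c) ((G.isDomainFun_rep u).continuous.smul c) e

variable (q α)

/-- The Schrödinger operator `A_α f = 𝓛 f` in `L²(G)` with `δ`-type vertex conditions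
`∂_ν f(v) = α_v f(v)`. -/
def operator : G.L2 →ₗ.[ℂ] G.L2 where
  domain := G.domain q α
  toFun :=
    { toFun := fun u => WithLp.toLp 2 fun e => ((G.isDomainFun_rep u).memLp e).toLp _
      map_add' := by
        intro u w
        ext1 e
        have hu := (G.isDomainFun_rep u).memLp e
        have hw := (G.isDomainFun_rep w).memLp e
        change MemLp.toLp _ ((G.isDomainFun_rep (u + w)).memLp e) = hu.toLp _ + hw.toLp _
        rw [← MemLp.toLp_add hu hw]
        refine MemLp.toLp_congr _ _ ?_
        refine EventuallyEq.trans ?_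
          (schrodinger_add q (G.isDomainFun_rep u).ac2 (G.isDomainFun_rep w).ac2 e)
        filter_upwards [ae_restrict_mem (measurableSet_Icc : MeasurableSet (G.edge e))] with x hx
        exact schrodinger_congr (G.rep_add u w) q e hx
      map_smul' := by
        intro c u
        ext1 e
        have hu := (G.isDomainFun_rep u).memLp e
        change MemLp.toLp _ ((G.isDomainFun_rep (c • u)).memLp e) = c • hu.toLp _
        rw [← MemLp.toLp_const_smul c hu]
        refine MemLp.toLp_congr _ _ ?_
        refine EventuallyEq.trans ?_ (schrodinger_smul q c (G.isDomainFun_rep u).ac2 e)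
        filter_upwards [ae_restrict_mem (measurableSet_Icc : MeasurableSet (G.edge e))] with x hx
        exact schrodinger_congr (G.rep_smul c u) q e hx }

/-- The linear map `f ↦ (f(v))_{v ∈ B}` on `dom A_α`. -/
def trace (B : Finset V) : (G.operator q α).domain →ₗ[ℂ] (B → ℂ) where
  toFun u := fun v => G.vertexValue (G.rep (q := q) (α := α) u) v
  map_add' u w := by
    funext v
    exact (vertexValue_congr (G.rep_add (q := q) (α := α) u w) v).trans (vertexValue_add _ _ _)
  map_smul' c u := by
    funext v
    exact (vertexValue_congr (G.rep_smul (q := q) (α := α) c u) v).trans (vertexValue_smul _ _ _)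

/-- The trace map `γ_λ : ker (A_α - λ) → ℂ^B`, `f ↦ (f(v))_{v ∈ B}`. -/
def gamma (B : Finset V) (μ : ℂ) : (G.operator q α).eigenKer μ →ₗ[ℂ] (B → ℂ) :=
  (G.trace q α B).domRestrict ((G.operator q α).eigenKer μ)

/-! ### The Titchmarsh–Weyl function -/

open Classical in
/-- `f ∈ L²(G) ∩ AC²(G)` is continuous on `G`, `𝓛 f = μ f`, and `∂_ν f(w) - α_w f(w)` is `1` at
`w = v` and `0` at all other vertices. -/
structure IsWeylSolution (μ : ℂ) (v : V) (f : E → ℝ → ℂ) : Prop where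
  ac2 : G.IsAC2 f
  continuous : G.IsContinuous f
  equation : ∀ e, ∀ᵐ x ∂(volume : Measure ℝ).restrict (G.edge e),
    G.schrodinger q f e x = μ * f e x
  data : ∀ w, G.deltaData α f w = if w = v then 1 else 0

open Classical in
/-- The Titchmarsh–Weyl function `M_{B,α}`: the entry `(k, l)` of `M_{B,α}(μ)` is `f(k)`, where `f`
is the Weyl solution for `μ` and the vertex `l`. This is used only for `μ` outside the
spectrum of `A_α`, where `f` exists and is unique on the edges. -/
def titchmarshWeyl (B : Finset V) (μ : ℂ) : Matrix B B ℂ :=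
  Matrix.of fun k l =>
    if h : ∃ f, G.IsWeylSolution q α μ l f then G.vertexValue h.choose k else 0

end MetricGraph

end

/-!
On an edge `[0, L]` the equation `-f'' + q f = μ f` with prescribed `f 0 = a`, `f' 0 = b` is the
Volterra equation `u = a + b x + ∫₀ˣ ∫₀ˢ (q - μ) u` in `C[0, L]`. The iterates of the integral
operator have norm `O(cⁿ / n!)`, so the equation is uniquely solvable for every `μ`
(`Volterra.isUnit_one_sub`), and since inversion in a Banach algebra is analytic, the solution
depends analytically on `μ ∈ ℂ` (`SturmLiouville.analyticOnNhd_cauchySol`). The matching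
conditions at the vertices then form a finite system of linear equations, whose matrix is entire
in `μ`: the characteristic map `MetricGraph.charMap`.

A vector in the kernel of the characteristic map at `μ` describes an element of `ker (A_α - μ)`.
Conversely, if this kernel is trivial, then `A_α - μ` is bijective, and the closed graph theorem
together with the symmetry of `A_α` bounds the inverse. So the spectrum is the zero set of an
entire function (`MetricGraph.notMem_spectrum_iff`). By Lagrange's identity
(`MetricGraph.lagrange`) it is real; in particular its points are isolated. The Weyl solutions are
given by Cramer's rule, which yields their existence, uniqueness, analyticity and meromorphy.

The principal parts at a real point `t` follow from Lagrange's identity applied to a Weyl solution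
`f_μ` for the vertex `v` and an eigenfunction `g` at `t`: it says
`(μ - t) ⟨f_μ, g⟩ = -conj (g v)`. If `(μ - t)ⁿ f_μ` tends to `F` with `n ≥ 1`, then
`F ∈ ker (A_α - t)`, and `⟨F, g⟩` is the limit of `-(μ - t)ⁿ⁻¹ conj (g v)`
(`MetricGraph.pairing_glue_of_eventually`). For `n ≥ 2` this limit is `0` for all `g`, whence
`F = 0`: poles are simple. For `n = 1` the limits `F` for the vertices in `B` are the values of
`-γ*` at the unit vectors, so that the residue of the Titchmarsh–Weyl function is `-γ γ*`. Its
range is the range of `γ`, and the dimension formula is the rank–nullity theorem for `γ`.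
-/

open scoped ComplexConjugate

/-! ### Absolutely continuous functions -/

lemma AbsolutelyContinuousOnInterval.of_dist_le {X Y : Type*} [PseudoMetricSpace X]
    [PseudoMetricSpace Y] {f : ℝ → X} {g : ℝ → Y} {a b : ℝ}
    (hg : AbsolutelyContinuousOnInterval g a b)
    (h : ∀ x ∈ uIcc a b, ∀ y ∈ uIcc a b, dist (f x) (f y) ≤ dist (g x) (g y)) :
    AbsolutelyContinuousOnInterval f a b := by
  rw [absolutelyContinuousOnInterval_iff] at hg ⊢
  intro ε hε
  obtain ⟨δ, hδ, H⟩ := hg ε hε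
  refine ⟨δ, hδ, fun I hI hs => (Finset.sum_le_sum fun i hi => ?_).trans_lt (H I hI hs)⟩
  exact h _ (hI.1 i hi).1 _ (hI.1 i hi).2

lemma IntervalIntegrable.absolutelyContinuousOnInterval_integral {F : Type*}
    [NormedAddCommGroup F] [NormedSpace ℝ F] {f : ℝ → F} {a b : ℝ}
    (h : IntervalIntegrable f volume a b) :
    AbsolutelyContinuousOnInterval (fun x => ∫ t in a..x, f t) a b := by
  refine (h.norm.absolutelyContinuousOnInterval_intervalIntegral
    (c := a) left_mem_uIcc).of_dist_le fun x hx y hy => ?_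
  have hax : uIcc a x ⊆ uIcc a b := uIcc_subset_uIcc left_mem_uIcc hx
  have hay : uIcc a y ⊆ uIcc a b := uIcc_subset_uIcc left_mem_uIcc hy
  rw [dist_eq_norm, dist_eq_norm, intervalIntegral.integral_interval_sub_left
    (h.mono_set hax) (h.mono_set hay), intervalIntegral.integral_interval_sub_left
    (h.norm.mono_set hax) (h.norm.mono_set hay), Real.norm_eq_abs]
  exact intervalIntegral.norm_integral_le_abs_integral_norm

/-- The fundamental theorem of calculus for absolutely continuous functions with values in a
Banach space, whose almost everywhere derivative is known to exist and to be integrable. -/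
lemma AbsolutelyContinuousOnInterval.integral_eq_sub_of_ae_hasDerivAt {F : Type*}
    [NormedAddCommGroup F] [NormedSpace ℝ F] [CompleteSpace F] {f f' : ℝ → F} {a b : ℝ}
    (hf : AbsolutelyContinuousOnInterval f a b) (h : ∀ᵐ x, x ∈ uIcc a b → HasDerivAt f (f' x) x)
    (hf' : IntervalIntegrable f' volume a b) : ∫ t in a..b, f' t = f b - f a := by
  have g_ac := hf.sub hf'.absolutelyContinuousOnInterval_integral
  obtain ⟨C, hC⟩ := g_ac.const_of_ae_hasDerivAt_zero (by
    filter_upwards [h, hf'.ae_hasDerivAt_integral] with x h1 h2 hx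
    simpa using (h1 hx).sub (h2 hx a left_mem_uIcc))
  have ha := hC a left_mem_uIcc
  have hb := hC b right_mem_uIcc
  simp only [Pi.sub_apply, intervalIntegral.integral_same, sub_zero] at ha hb
  rw [ha, ← hb]
  abel

/-! ### Volterra operators -/

namespace Volterra

variable {L : ℝ} (hL : 0 ≤ L)

lemma intervalIntegrable {p : ℝ → ℂ} (hp : IntegrableOn p (Icc 0 L)) {a b : ℝ}
    (ha : a ∈ Icc 0 L) (hb : b ∈ Icc 0 L) : IntervalIntegrable p volume a b :=
  (hp.mono_set ((ordConnected_Icc.uIcc_subset ha hb))).intervalIntegrable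

lemma integrableOn_mul {p : ℝ → ℂ} (hp : IntegrableOn p (Icc 0 L)) (u : C(Icc 0 L, ℂ)) :
    IntegrableOn (fun t => p t * IccExtend hL u t) (Icc 0 L) :=
  hp.mul_continuousOn (u.continuous.Icc_extend' (h := hL)).continuousOn isCompact_Icc

lemma continuous_integral {p : ℝ → ℂ} (hp : IntegrableOn p (Icc 0 L)) (u : C(Icc 0 L, ℂ)) :
    Continuous fun x : Icc 0 L => ∫ t in (0 : ℝ)..x, p t * IccExtend hL u t := by
  have h := intervalIntegral.continuousOn_primitive_interval
    (a := 0) (b := L) (μ := volume) (f := fun t => p t * IccExtend hL u t)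
    (by rw [uIcc_of_le hL]; exact integrableOn_mul hL hp u)
  rw [uIcc_of_le hL] at h
  exact h.domRestrict

/-- The Volterra operator `u ↦ (x ↦ ∫₀ˣ p u)` on `C[0, L]`, for an integrable weight `p`. -/
noncomputable def op {p : ℝ → ℂ} (hp : IntegrableOn p (Icc 0 L)) :
    C(Icc 0 L, ℂ) →L[ℂ] C(Icc 0 L, ℂ) :=
  LinearMap.mkContinuous
    { toFun := fun u => ⟨_, continuous_integral hL hp u⟩
      map_add' := fun u v => by
        ext x
        have hx := x.2
        have h0 : (0 : ℝ) ∈ Icc 0 L := ⟨le_rfl, hL⟩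
        change ∫ t in (0 : ℝ)..x, p t * IccExtend hL (u + v) t =
          (∫ t in (0 : ℝ)..x, p t * IccExtend hL u t) + ∫ t in (0 : ℝ)..x, p t * IccExtend hL v t
        rw [← intervalIntegral.integral_add
          (intervalIntegrable (integrableOn_mul hL hp u) h0 hx)
          (intervalIntegrable (integrableOn_mul hL hp v) h0 hx)]
        simp only [IccExtend, Function.comp_apply, ContinuousMap.add_apply, mul_add]
      map_smul' := fun c u => by
        ext x
        change ∫ t in (0 : ℝ)..x, p t * IccExtend hL (c • u) t =
          c * ∫ t in (0 : ℝ)..x, p t * IccExtend hL u t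
        rw [← intervalIntegral.integral_const_mul]
        simp only [IccExtend, Function.comp_apply, ContinuousMap.smul_apply, smul_eq_mul,
          mul_left_comm] }
    (∫ t in (0 : ℝ)..L, ‖p t‖) (fun u => by
      refine (ContinuousMap.norm_le _ (by
        refine mul_nonneg ?_ (norm_nonneg _)
        exact intervalIntegral.integral_nonneg hL fun t _ => norm_nonneg _)).2 fun x => ?_
      have h0 : (0 : ℝ) ∈ Icc 0 L := ⟨le_rfl, hL⟩
      have hl : L ∈ Icc 0 L := ⟨hL, le_rfl⟩
      have hx0 : (0 : ℝ) ≤ x := x.2.1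
      change ‖∫ t in (0 : ℝ)..x, p t * IccExtend hL u t‖ ≤ _
      calc _ ≤ ∫ t in (0 : ℝ)..x, ‖p t‖ * ‖u‖ := by
            refine intervalIntegral.norm_integral_le_of_norm_le hx0 (ae_of_all _ fun t _ => ?_)
              ((intervalIntegrable hp h0 x.2).norm.mul_const _)
            rw [norm_mul]
            gcongr
            exact u.norm_coe_le_norm _
        _ = (∫ t in (0 : ℝ)..x, ‖p t‖) * ‖u‖ := intervalIntegral.integral_mul_const _ _
        _ ≤ _ := by
            gcongr
            exact intervalIntegral.integral_mono_interval le_rfl hx0 x.2.2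
              (ae_of_all _ fun t => norm_nonneg _) (intervalIntegrable hp h0 hl).norm)

lemma op_apply {p : ℝ → ℂ} (hp : IntegrableOn p (Icc 0 L)) (u : C(Icc 0 L, ℂ)) (x : Icc 0 L) :
    op hL hp u x = ∫ t in (0 : ℝ)..x, p t * IccExtend hL u t := rfl

lemma integrableOn_one : IntegrableOn (fun _ : ℝ => (1 : ℂ)) (Icc 0 L) :=
  integrableOn_const (by simp)

/-- `u ↦ (x ↦ ∫₀ˣ u)` on `C[0, L]`. -/
noncomputable def prim : C(Icc 0 L, ℂ) →L[ℂ] C(Icc 0 L, ℂ) := op hL integrableOn_one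

lemma prim_apply (u : C(Icc 0 L, ℂ)) (x : Icc 0 L) :
    prim hL u x = ∫ t in (0 : ℝ)..x, IccExtend hL u t := by
  simp [prim, op_apply]

lemma op_sub_const {p : ℝ → ℂ} (hp : IntegrableOn p (Icc 0 L)) (μ : ℂ)
    (hp' : IntegrableOn (fun t => p t - μ) (Icc 0 L)) :
    op hL hp' = op hL hp - μ • prim hL := by
  ext u x
  have h0 : (0 : ℝ) ∈ Icc 0 L := ⟨le_rfl, hL⟩
  simp only [sub_apply, smul_apply, ContinuousMap.sub_apply,
    ContinuousMap.smul_apply, op_apply, prim, smul_eq_mul]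
  rw [← intervalIntegral.integral_const_mul, ← intervalIntegral.integral_sub
    (intervalIntegrable (integrableOn_mul hL hp u) h0 x.2)
    ((intervalIntegrable (integrableOn_mul hL integrableOn_one u) h0 x.2).const_mul _)]
  simp only [one_mul, sub_mul]

/-- Pointwise bound for `∫₀ˣ ∫₀ˢ p u`; the outer integration only contributes a factor `L`. -/
lemma norm_prim_op_apply_le {p : ℝ → ℂ} (hp : IntegrableOn p (Icc 0 L)) (u : C(Icc 0 L, ℂ))
    (x : Icc 0 L) {b : ℝ → ℝ} (hb : ContinuousOn b (Icc 0 L))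
    (hub : ∀ t : Icc 0 L, ‖u t‖ ≤ b t) :
    ‖prim hL (op hL hp u) x‖ ≤ ∫ t in (0 : ℝ)..x, (L * ‖p t‖) * b t := by
  have h0 : (0 : ℝ) ∈ Icc 0 L := ⟨le_rfl, hL⟩
  have hint : IntegrableOn (fun t => ‖p t‖ * b t) (Icc 0 L) :=
    IntegrableOn.mul_continuousOn hp.norm hb isCompact_Icc
  have hii : ∀ y ∈ Icc 0 L, IntervalIntegrable (fun t => ‖p t‖ * b t) volume 0 y := fun y hy =>
    (hint.mono_set (ordConnected_Icc.uIcc_subset h0 hy)).intervalIntegrable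
  have hpos : ∀ t ∈ Icc 0 L, 0 ≤ ‖p t‖ * b t := fun t ht =>
    mul_nonneg (norm_nonneg _) ((norm_nonneg _).trans (hub ⟨t, ht⟩))
  have hinner : ∀ s ∈ uIoc (0 : ℝ) x,
      ‖IccExtend hL (op hL hp u) s‖ ≤ ∫ t in (0 : ℝ)..x, ‖p t‖ * b t := by
    intro s hs
    rw [uIoc_of_le x.2.1] at hs
    have hsL : s ∈ Icc 0 L := ⟨hs.1.le, hs.2.trans x.2.2⟩
    rw [IccExtend_of_mem hL _ hsL, op_apply]
    calc _ ≤ ∫ t in (0 : ℝ)..s, ‖p t‖ * b t := by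
          refine intervalIntegral.norm_integral_le_of_norm_le hsL.1 (ae_of_all _ fun t ht => ?_)
            (hii s hsL)
          have htL : t ∈ Icc 0 L := ⟨ht.1.le, ht.2.trans hsL.2⟩
          rw [norm_mul, IccExtend_of_mem hL _ htL]
          gcongr
          exact hub ⟨t, htL⟩
      _ ≤ _ := by
          refine intervalIntegral.integral_mono_interval le_rfl hsL.1 hs.2 ?_ (hii x x.2)
          filter_upwards [ae_restrict_mem measurableSet_Ioc] with t ht
          exact hpos t ⟨ht.1.le, ht.2.trans x.2.2⟩
  rw [prim_apply]
  refine (intervalIntegral.norm_integral_le_of_norm_le_const hinner).trans ?_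
  simp only [mul_assoc, intervalIntegral.integral_const_mul]
  rw [mul_comm, sub_zero, abs_of_nonneg x.2.1]
  refine mul_le_mul_of_nonneg_right x.2.2 ?_
  exact intervalIntegral.integral_nonneg x.2.1 fun t ht => hpos t ⟨ht.1, ht.2.trans x.2.2⟩

lemma integral_mul_primitive_pow {w : ℝ → ℝ} {x : ℝ} (hw : IntervalIntegrable w volume 0 x)
    (n : ℕ) : ∫ t in (0 : ℝ)..x, w t * (∫ s in (0 : ℝ)..t, w s) ^ n =
      (∫ s in (0 : ℝ)..x, w s) ^ (n + 1) / (n + 1) := by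
  have hac := hw.absolutelyContinuousOnInterval_integral
  have hpow : ∀ n : ℕ, AbsolutelyContinuousOnInterval
      (fun t => (∫ s in (0 : ℝ)..t, w s) ^ n) 0 x := by
    intro n
    induction n with
    | zero =>
      simp only [pow_zero]
      exact ((LipschitzWith.const (1 : ℝ)).lipschitzOnWith
        (s := uIcc 0 x)).absolutelyContinuousOnInterval
    | succ n ih => simp only [pow_succ]; exact ih.mul hac
  have h := (hpow (n + 1)).integral_eq_sub_of_ae_hasDerivAt
    (f' := fun t => (n + 1) * (w t * (∫ s in (0 : ℝ)..t, w s) ^ n)) (by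
      filter_upwards [hw.ae_hasDerivAt_integral] with t h1 ht
      refine ((h1 ht 0 left_mem_uIcc).fun_pow (n + 1)).congr_deriv ?_
      push_cast
      ring)
    ((hw.mul_continuousOn (hpow n).continuousOn).const_mul _)
  rw [intervalIntegral.integral_const_mul] at h
  simp only [intervalIntegral.integral_same] at h
  rw [eq_div_iff (by positivity), mul_comm, h]
  simp

/-- The iterates of `u ↦ ∫₀ˣ ∫₀ˢ p u`, estimated by `Wⁿ / n!` with the primitive `W` of `L ‖p‖`. -/
lemma norm_pow_apply_le {p : ℝ → ℂ} (hp : IntegrableOn p (Icc 0 L)) (n : ℕ) (u : C(Icc 0 L, ℂ))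
    (x : Icc 0 L) : ‖((prim hL * op hL hp) ^ n) u x‖ ≤
      ‖u‖ * ((∫ t in (0 : ℝ)..x, L * ‖p t‖) ^ n / n.factorial) := by
  have h0 : (0 : ℝ) ∈ Icc 0 L := ⟨le_rfl, hL⟩
  have hw : IntegrableOn (fun t => L * ‖p t‖) (Icc 0 L) := hp.norm.const_mul L
  have hwi : ∀ y ∈ Icc 0 L, IntervalIntegrable (fun t => L * ‖p t‖) volume 0 y := fun y hy =>
    (hw.mono_set (ordConnected_Icc.uIcc_subset h0 hy)).intervalIntegrable
  induction n generalizing x with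
  | zero => simpa using u.norm_coe_le_norm x
  | succ n ih =>
    have hc : ContinuousOn (fun y => ∫ t in (0 : ℝ)..y, L * ‖p t‖) (Icc 0 L) := by
      have := (hwi L ⟨hL, le_rfl⟩).absolutelyContinuousOnInterval_integral.continuousOn
      rwa [uIcc_of_le hL] at this
    rw [pow_succ', mul_apply_eq_comp, mul_apply_eq_comp]
    refine (norm_prim_op_apply_le hL hp _ x
      (b := fun y => ‖u‖ * ((∫ t in (0 : ℝ)..y, L * ‖p t‖) ^ n / n.factorial))
      (continuousOn_const.mul ((hc.pow n).div_const _)) ih).trans_eq ?_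
    have : ∀ t, L * ‖p t‖ * (‖u‖ * ((∫ s in (0 : ℝ)..t, L * ‖p s‖) ^ n / n.factorial)) =
        (‖u‖ / n.factorial) * (L * ‖p t‖ * (∫ s in (0 : ℝ)..t, L * ‖p s‖) ^ n) := fun t => by
      ring
    rw [intervalIntegral.integral_congr fun t _ => this t, intervalIntegral.integral_const_mul,
      integral_mul_primitive_pow (hwi x x.2), Nat.factorial_succ]
    push_cast
    field_simp

lemma _root_.isUnit_one_sub_of_norm_pow_lt_one {R : Type*} [NormedRing R] [CompleteSpace R]
    (K : R) (n : ℕ) (h : ‖K ^ n‖ < 1) : IsUnit (1 - K) := by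
  have hu : IsUnit (1 - K ^ n) := isUnit_one_sub_of_norm_lt_one h
  rw [← mul_neg_geom_sum K n] at hu
  have hcomm : Commute (1 - K) (∑ i ∈ Finset.range n, K ^ i) :=
    (Commute.one_left _).sub_left (Commute.sum_right _ _ _ fun i _ => Commute.self_pow K i)
  exact (hcomm.isUnit_mul_iff.1 hu).1

/-- The operator `u ↦ u - ∫₀ˣ ∫₀ˢ p u` on `C[0, L]` is invertible, because the iterates of
`u ↦ ∫₀ˣ ∫₀ˢ p u` have norm `O(cⁿ / n!)`. -/
lemma isUnit_one_sub {p : ℝ → ℂ} (hp : IntegrableOn p (Icc 0 L)) :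
    IsUnit (1 - prim hL * op hL hp) := by
  have h0 : (0 : ℝ) ∈ Icc 0 L := ⟨le_rfl, hL⟩
  set K := prim hL * op hL hp
  set c := ∫ t in (0 : ℝ)..L, L * ‖p t‖
  obtain ⟨n, hn⟩ := ((FloorSemiring.tendsto_pow_div_factorial_atTop c).eventually_lt_const
    one_pos).exists
  have hw : IntervalIntegrable (fun t => L * ‖p t‖) volume 0 L :=
    (intervalIntegrable hp h0 ⟨hL, le_rfl⟩).norm.const_mul L
  have hc : 0 ≤ c := intervalIntegral.integral_nonneg hL fun t _ => by positivity
  have hK : ‖K ^ n‖ ≤ c ^ n / n.factorial := by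
    refine ContinuousLinearMap.opNorm_le_bound _ (by positivity) fun u => ?_
    refine (ContinuousMap.norm_le _ (by positivity)).2 fun x => ?_
    refine (norm_pow_apply_le hL hp n u x).trans ?_
    rw [mul_comm]
    gcongr
    · exact intervalIntegral.integral_nonneg x.2.1 fun t _ => by positivity
    · exact intervalIntegral.integral_mono_interval le_rfl x.2.1 x.2.2
        (ae_of_all _ fun t => by positivity) hw
  exact isUnit_one_sub_of_norm_pow_lt_one K n (hK.trans_lt hn)

end Volterra

/-! ### Second order equations on an interval -/

namespace SturmLiouville

open Volterra

/-- `f` belongs to `AC²[0, L]`, and `f'' = r` almost everywhere on `[0, L]`. -/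
structure HasSecondDeriv (L : ℝ) (f r : ℝ → ℂ) : Prop where
  differentiableOn : DifferentiableOn ℝ f (Icc 0 L)
  ac : AbsolutelyContinuousOnInterval f 0 L
  ac_deriv : AbsolutelyContinuousOnInterval (derivWithin f (Icc 0 L)) 0 L
  ae_eq : ∀ᵐ x ∂(volume : Measure ℝ).restrict (Icc 0 L),
    derivWithin (derivWithin f (Icc 0 L)) (Icc 0 L) x = r x

variable {L : ℝ}

lemma ae_hasDerivAt_derivWithin (hL : 0 < L) {f : ℝ → ℂ}
    (hf : AbsolutelyContinuousOnInterval f 0 L) :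
    ∀ᵐ x, x ∈ uIcc 0 L → HasDerivAt f (derivWithin f (Icc 0 L) x) x := by
  filter_upwards [hf.boundedVariationOn.ae_differentiableAt_of_mem_uIcc] with x hx hx'
  rw [(hx hx').derivWithin (uniqueDiffOn_Icc hL x (by rwa [uIcc_of_le hL.le] at hx'))]
  exact (hx hx').hasDerivAt

lemma HasSecondDeriv.ae_hasDerivAt (hL : 0 < L) {f r : ℝ → ℂ} (h : HasSecondDeriv L f r) :
    ∀ᵐ x, x ∈ uIcc 0 L → HasDerivAt (derivWithin f (Icc 0 L)) (r x) x := by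
  filter_upwards [ae_hasDerivAt_derivWithin hL h.ac_deriv,
    (ae_restrict_iff' measurableSet_Icc).1 h.ae_eq] with x h1 h2 hx
  rw [← h2 (by rwa [uIcc_of_le hL.le] at hx)]
  exact h1 hx

lemma HasSecondDeriv.deriv_eq_integral (hL : 0 < L) {f r : ℝ → ℂ} (h : HasSecondDeriv L f r)
    (hr : IntegrableOn r (Icc 0 L)) {x : ℝ} (hx : x ∈ Icc 0 L) :
    derivWithin f (Icc 0 L) x = derivWithin f (Icc 0 L) 0 + ∫ t in (0 : ℝ)..x, r t := by
  have h0 : (0 : ℝ) ∈ Icc 0 L := ⟨le_rfl, hL.le⟩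
  have hs : uIcc 0 x ⊆ uIcc 0 L := uIcc_subset_uIcc left_mem_uIcc (by rwa [uIcc_of_le hL.le])
  rw [(h.ac_deriv.mono hs).integral_eq_sub_of_ae_hasDerivAt (f' := r) _
    (intervalIntegrable hr h0 hx)]
  · ring
  · filter_upwards [h.ae_hasDerivAt hL] with y hy hy' using hy (hs hy')

lemma HasSecondDeriv.eq_integral (hL : 0 < L) {f r : ℝ → ℂ} (h : HasSecondDeriv L f r)
    {x : ℝ} (hx : x ∈ Icc 0 L) :
    f x = f 0 + ∫ t in (0 : ℝ)..x, derivWithin f (Icc 0 L) t := by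
  have h0 : (0 : ℝ) ∈ Icc 0 L := ⟨le_rfl, hL.le⟩
  have hs : uIcc 0 x ⊆ uIcc 0 L := uIcc_subset_uIcc left_mem_uIcc (by rwa [uIcc_of_le hL.le])
  rw [(h.ac.mono hs).integral_eq_sub_of_ae_hasDerivAt _
    (h.ac_deriv.continuousOn.mono hs).intervalIntegrable]
  · ring
  · filter_upwards [ae_hasDerivAt_derivWithin hL h.ac] with y hy hy' using hy (hs hy')

/-- A function that arises from an integrable `r` by integrating twice is in `AC²[0, L]`. -/
lemma hasSecondDeriv_of_integral (hL : 0 < L) {f f₁ r : ℝ → ℂ} (hr : IntegrableOn r (Icc 0 L))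
    (hf : ∀ x ∈ Icc 0 L, f x = f 0 + ∫ t in (0 : ℝ)..x, f₁ t)
    (hf₁ : ∀ x ∈ Icc 0 L, f₁ x = f₁ 0 + ∫ t in (0 : ℝ)..x, r t) :
    HasSecondDeriv L f r ∧ EqOn (derivWithin f (Icc 0 L)) f₁ (Icc 0 L) := by
  have h0 : (0 : ℝ) ∈ Icc 0 L := ⟨le_rfl, hL.le⟩
  have hl : L ∈ Icc 0 L := ⟨hL.le, le_rfl⟩
  have huI : uIcc 0 L = Icc 0 L := uIcc_of_le hL.le
  have hri := intervalIntegrable hr h0 hl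
  have hconst : ∀ c : ℂ, AbsolutelyContinuousOnInterval (fun _ => c) 0 L := fun c =>
    ((LipschitzWith.const c).lipschitzOnWith (s := uIcc 0 L)).absolutelyContinuousOnInterval
  have hac₁ : AbsolutelyContinuousOnInterval f₁ 0 L :=
    ((hconst (f₁ 0)).add hri.absolutelyContinuousOnInterval_integral).congr_edge
      (by rw [huI]; exact fun x hx => (hf₁ x hx).symm)
  have hc₁ : ContinuousOn f₁ (Icc 0 L) := huI ▸ hac₁.continuousOn
  have hii : IntervalIntegrable f₁ volume 0 L := hac₁.continuousOn.intervalIntegrable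
  have hder : ∀ x ∈ Icc 0 L, HasDerivWithinAt f (f₁ x) (Icc 0 L) x := by
    intro x hx
    have : Fact (x ∈ Icc 0 L) := ⟨hx⟩
    have hm : StronglyMeasurableAtFilter f₁ (𝓝[Icc 0 L] x) volume :=
      hc₁.stronglyMeasurableAtFilter_nhdsWithin measurableSet_Icc x
    have := (intervalIntegral.integral_hasDerivWithinAt_right (s := Icc 0 L) (t := Icc 0 L)
      (a := 0) (b := x) (hii.mono_set (by rw [huI]; exact ordConnected_Icc.uIcc_subset h0 hx))
      hm (hc₁ x hx)).const_add (f 0)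
    exact this.congr hf (hf x hx)
  have heq : EqOn (derivWithin f (Icc 0 L)) f₁ (Icc 0 L) := fun x hx =>
    (hder x hx).derivWithin (uniqueDiffOn_Icc hL x hx)
  refine ⟨⟨fun x hx => (hder x hx).differentiableWithinAt, ?_, ?_, ?_⟩, heq⟩
  · exact ((hconst (f 0)).add hii.absolutelyContinuousOnInterval_integral).congr_edge
      (by rw [huI]; exact fun x hx => (hf x hx).symm)
  · exact hac₁.congr_edge (by rw [huI]; exact heq.symm)
  · filter_upwards [ae_restrict_mem measurableSet_Icc,
      ae_restrict_of_ae hri.ae_hasDerivAt_integral] with x hx h1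
    rw [derivWithin_congr heq (heq hx)]
    have h2 := ((h1 (huI ▸ hx) 0 left_mem_uIcc).hasDerivWithinAt (s := Icc 0 L)).const_add (f₁ 0)
    exact (h2.congr hf₁ (hf₁ x hx)).derivWithin (uniqueDiffOn_Icc hL x hx)

/-- Lagrange's identity on an interval. -/
lemma HasSecondDeriv.lagrange (hL : 0 < L) {f r g s : ℝ → ℂ} (hf : HasSecondDeriv L f r)
    (hr : IntegrableOn r (Icc 0 L)) (hg : HasSecondDeriv L g s) (hs : IntegrableOn s (Icc 0 L)) :
    ∫ t in (0 : ℝ)..L, (r t * conj (g t) - f t * conj (s t)) =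
      (derivWithin f (Icc 0 L) L * conj (g L) - f L * conj (derivWithin g (Icc 0 L) L)) -
      (derivWithin f (Icc 0 L) 0 * conj (g 0) - f 0 * conj (derivWithin g (Icc 0 L) 0)) := by
  have h0 : (0 : ℝ) ∈ Icc 0 L := ⟨le_rfl, hL.le⟩
  have hl : L ∈ Icc 0 L := ⟨hL.le, le_rfl⟩
  have hstar : ∀ {k : ℝ → ℂ}, AbsolutelyContinuousOnInterval k 0 L →
      AbsolutelyContinuousOnInterval (fun t => conj (k t)) 0 L := fun hk =>
    hk.of_dist_le fun x _ y _ => by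
      rw [dist_eq_norm, dist_eq_norm, ← map_sub, RCLike.norm_conj]
  have hac := (hf.ac_deriv.smul (hstar hg.ac)).sub (hf.ac.smul (hstar hg.ac_deriv))
  have hsi : IntervalIntegrable (fun t => conj (s t)) volume 0 L := by
    have := intervalIntegrable hs h0 hl
    rw [intervalIntegrable_iff] at this ⊢
    exact Complex.conjLIE.integrable_comp_iff.2 this
  refine hac.integral_eq_sub_of_ae_hasDerivAt ?_ ?_
  · filter_upwards [hf.ae_hasDerivAt hL, hg.ae_hasDerivAt hL, ae_hasDerivAt_derivWithin hL hf.ac,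
      ae_hasDerivAt_derivWithin hL hg.ac] with x h1 h2 h3 h4 hx
    refine (((h1 hx).mul (h4 hx).star).sub ((h3 hx).mul (h2 hx).star)).congr_deriv ?_
    simp only [RCLike.star_def]
    ring
  · exact ((intervalIntegrable hr h0 hl).mul_continuousOn (hstar hg.ac).continuousOn).sub
      (hsi.continuousOn_mul hf.ac.continuousOn)

section Pencil

variable (hL : 0 ≤ L) {p : ℝ → ℂ} (hp : IntegrableOn p (Icc 0 L))

/-- The function `x ↦ a + b x` in `C[0, L]`. -/
noncomputable def affine (L : ℝ) (a b : ℂ) : C(Icc 0 L, ℂ) :=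
  ⟨fun x => a + b * ((x : ℝ) : ℂ), by fun_prop⟩

/-- The operator `u ↦ ∫₀ˣ (p - μ) u` on `C[0, L]`. -/
noncomputable def weight (μ : ℂ) : C(Icc 0 L, ℂ) →L[ℂ] C(Icc 0 L, ℂ) :=
  op hL hp - μ • prim hL

lemma integrableOn_sub_const {p : ℝ → ℂ} (hp : IntegrableOn p (Icc 0 L)) (μ : ℂ) :
    IntegrableOn (fun t => p t - μ) (Icc 0 L) :=
  Integrable.sub hp (integrableOn_const (by simp))

lemma weight_eq (μ : ℂ) : weight hL hp μ = op hL (integrableOn_sub_const hp μ) :=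
  (op_sub_const hL hp μ _).symm

/-- The solution `u ∈ C[0, L]` of the Volterra equation `u = h + ∫₀ˣ ∫₀ˢ (p - μ) u`. -/
noncomputable def sol (μ : ℂ) (h : C(Icc 0 L, ℂ)) : C(Icc 0 L, ℂ) :=
  Ring.inverse (1 - prim hL * weight hL hp μ) h

lemma isUnit_pencil (μ : ℂ) : IsUnit (1 - prim hL * weight hL hp μ) := by
  rw [weight_eq]
  exact isUnit_one_sub hL _

lemma sol_eq (μ : ℂ) (h : C(Icc 0 L, ℂ)) :
    sol hL hp μ h = h + prim hL (weight hL hp μ (sol hL hp μ h)) := by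
  have := congrArg (fun T : C(Icc 0 L, ℂ) →L[ℂ] C(Icc 0 L, ℂ) => T h)
    (Ring.mul_inverse_cancel _ (isUnit_pencil hL hp μ))
  simp only [mul_apply_eq_comp, sub_apply, one_apply_eq_self] at this
  exact sub_eq_iff_eq_add.1 this

lemma eq_sol {μ : ℂ} {h u : C(Icc 0 L, ℂ)} (hu : u = h + prim hL (weight hL hp μ u)) :
    u = sol hL hp μ h := by
  have := congrArg (fun T : C(Icc 0 L, ℂ) →L[ℂ] C(Icc 0 L, ℂ) => T u)
    (Ring.inverse_mul_cancel _ (isUnit_pencil hL hp μ))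
  simp only [mul_apply_eq_comp, sub_apply, one_apply_eq_self] at this
  rw [← sub_eq_iff_eq_add.2 hu]
  exact this.symm

lemma analyticAt_inverse_pencil {R : Type*} [NormedRing R] [NormedAlgebra ℂ R]
    [CompleteSpace R] (a b c : R) {μ : ℂ} (h : IsUnit (1 - a * (b - μ • c))) :
    AnalyticAt ℂ (fun μ : ℂ => Ring.inverse (1 - a * (b - μ • c))) μ :=
  AnalyticAt.fun_comp (analyticOnNhd_inverse (𝕜 := ℂ) _ h) (by fun_prop)

lemma analyticOnNhd_sol (h : C(Icc 0 L, ℂ)) :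
    AnalyticOnNhd ℂ (fun μ => sol hL hp μ h) univ := by
  intro μ _
  have h2 : AnalyticAt ℂ (fun μ => Ring.inverse (1 - prim hL * weight hL hp μ)) μ :=
    analyticAt_inverse_pencil (R := C(Icc 0 L, ℂ) →L[ℂ] C(Icc 0 L, ℂ)) (prim hL) (op hL hp)
      (prim hL) (isUnit_pencil hL hp μ)
  exact ((ContinuousLinearMap.apply ℂ C(Icc 0 L, ℂ) h).analyticAt _).fun_comp h2

lemma sol_add (μ : ℂ) (h k : C(Icc 0 L, ℂ)) :
    sol hL hp μ (h + k) = sol hL hp μ h + sol hL hp μ k := map_add _ _ _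

lemma sol_smul (μ c : ℂ) (h : C(Icc 0 L, ℂ)) :
    sol hL hp μ (c • h) = c • sol hL hp μ h := map_smul _ _ _

end Pencil

section Solution

variable (hL : 0 < L) {p : ℝ → ℂ} (hp : IntegrableOn p (Icc 0 L))

lemma weight_apply (μ : ℂ) (u : C(Icc 0 L, ℂ)) (x : Icc 0 L) :
    weight hL.le hp μ u x = ∫ t in (0 : ℝ)..x, (p t - μ) * IccExtend hL.le u t := by
  rw [weight_eq, op_apply]

/-- Solutions of the Volterra equation solve the differential equation `f'' = (p - μ) f - g`. -/
lemma hasSecondDeriv_of_volterra {g : ℝ → ℂ} (hg : IntegrableOn g (Icc 0 L)) {μ a b : ℂ}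
    {u : C(Icc 0 L, ℂ)}
    (hu : u = affine L a b - prim hL.le (op hL.le hg 1) + prim hL.le (weight hL.le hp μ u)) :
    HasSecondDeriv L (IccExtend hL.le u) (fun t => (p t - μ) * IccExtend hL.le u t - g t) ∧
      IccExtend hL.le u 0 = a ∧
      ∀ x : Icc 0 L, derivWithin (IccExtend hL.le u) (Icc 0 L) x =
        b + weight hL.le hp μ u x - op hL.le hg 1 x := by
  have h0 : (0 : ℝ) ∈ Icc 0 L := ⟨le_rfl, hL.le⟩
  set v : C(Icc 0 L, ℂ) := ContinuousMap.const _ b + weight hL.le hp μ u - op hL.le hg 1 with hv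
  have hr : IntegrableOn (fun t => (p t - μ) * IccExtend hL.le u t - g t) (Icc 0 L) :=
    Integrable.sub (integrableOn_mul hL.le (integrableOn_sub_const hp μ) u) hg
  have hcont : ∀ w : C(Icc 0 L, ℂ), ∀ x ∈ Icc 0 L,
      IntervalIntegrable (IccExtend hL.le w) volume 0 x := fun w x _ =>
    (w.continuous.Icc_extend' (h := hL.le)).intervalIntegrable _ _
  have hux : ∀ x : Icc 0 L, u x = a + ∫ t in (0 : ℝ)..x, IccExtend hL.le v t := by
    intro x
    have hx := congrArg (fun w : C(Icc 0 L, ℂ) => w x) hu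
    simp only [ContinuousMap.add_apply, ContinuousMap.sub_apply, prim_apply] at hx
    rw [hx]
    have : ∀ t, IccExtend hL.le v t =
        b + IccExtend hL.le (weight hL.le hp μ u) t - IccExtend hL.le (op hL.le hg 1) t :=
      fun t => rfl
    simp only [this]
    rw [intervalIntegral.integral_sub (intervalIntegrable_const.add (hcont _ x x.2))
      (hcont _ x x.2), intervalIntegral.integral_add intervalIntegrable_const (hcont _ x x.2)]
    simp only [affine, ContinuousMap.coe_mk, intervalIntegral.integral_const, sub_zero,
      Complex.real_smul]
    ring
  have hu0 : IccExtend hL.le u 0 = a := by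
    rw [IccExtend_of_mem hL.le _ h0, hux]
    simp
  have hvx : ∀ x : Icc 0 L, v x =
      b + ∫ t in (0 : ℝ)..x, ((p t - μ) * IccExtend hL.le u t - g t) := by
    intro x
    rw [intervalIntegral.integral_sub (intervalIntegrable
      (integrableOn_mul hL.le (integrableOn_sub_const hp μ) u) h0 x.2)
      (intervalIntegrable hg h0 x.2), ← weight_apply hL hp]
    have : op hL.le hg 1 x = ∫ t in (0 : ℝ)..x, g t := by
      simp [op_apply, IccExtend]
    rw [← this, hv]
    simp only [ContinuousMap.sub_apply, ContinuousMap.add_apply, ContinuousMap.const_apply]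
    ring
  obtain ⟨h1, h2⟩ := hasSecondDeriv_of_integral hL (f := IccExtend hL.le u)
    (f₁ := IccExtend hL.le v) hr
    (fun x hx => by rw [hu0, IccExtend_of_mem hL.le _ hx, hux])
    (fun x hx => by
      rw [IccExtend_of_mem hL.le _ hx, IccExtend_of_mem hL.le _ h0, hvx, hvx]
      simp)
  refine ⟨h1, hu0, fun x => ?_⟩
  rw [h2 x.2, IccExtend_of_mem hL.le _ x.2]
  rfl

/-- The solution of `f'' = (p - μ) f` with `f 0 = a` and `f' 0 = b`. -/
noncomputable def cauchySol (μ a b : ℂ) : C(Icc 0 L, ℂ) := sol hL.le hp μ (affine L a b)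

/-- The derivative of `cauchySol`, written as `b + ∫₀ˣ (p - μ) u`, which makes its analytic
dependence on `μ` visible. -/
noncomputable def cauchyDeriv (μ a b : ℂ) : C(Icc 0 L, ℂ) :=
  ContinuousMap.const _ b + weight hL.le hp μ (cauchySol hL hp μ a b)

lemma affine_add (a b a' b' : ℂ) : affine L (a + a') (b + b') = affine L a b + affine L a' b' := by
  ext x
  simp [affine]
  ring

lemma affine_smul (c a b : ℂ) : affine L (c * a) (c * b) = c • affine L a b := by
  ext x
  simp [affine]
  ring

lemma cauchySol_add (μ a b a' b' : ℂ) : cauchySol hL hp μ (a + a') (b + b') =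
    cauchySol hL hp μ a b + cauchySol hL hp μ a' b' := by
  rw [cauchySol, affine_add, sol_add]
  rfl

lemma cauchySol_zero (μ : ℂ) : cauchySol hL hp μ 0 0 = 0 := by
  have h := cauchySol_add hL hp μ 0 0 0 0
  rw [add_zero] at h
  exact left_eq_add.1 h

lemma cauchySol_smul (μ c a b : ℂ) : cauchySol hL hp μ (c * a) (c * b) =
    c • cauchySol hL hp μ a b := by
  rw [cauchySol, affine_smul, sol_smul]
  rfl

lemma cauchyDeriv_add (μ a b a' b' : ℂ) : cauchyDeriv hL hp μ (a + a') (b + b') =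
    cauchyDeriv hL hp μ a b + cauchyDeriv hL hp μ a' b' := by
  rw [cauchyDeriv, cauchySol_add, map_add]
  ext x
  simp only [cauchyDeriv, ContinuousMap.add_apply, ContinuousMap.const_apply]
  ring

lemma cauchyDeriv_smul (μ c a b : ℂ) : cauchyDeriv hL hp μ (c * a) (c * b) =
    c • cauchyDeriv hL hp μ a b := by
  rw [cauchyDeriv, cauchySol_smul, map_smul]
  ext x
  simp only [cauchyDeriv, ContinuousMap.add_apply, ContinuousMap.const_apply,
    ContinuousMap.smul_apply, smul_eq_mul]
  ring

lemma analyticOnNhd_cauchySol (a b : ℂ) :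
    AnalyticOnNhd ℂ (fun μ => cauchySol hL hp μ a b) univ :=
  analyticOnNhd_sol hL.le hp _

lemma analyticOnNhd_cauchyDeriv (a b : ℂ) :
    AnalyticOnNhd ℂ (fun μ => cauchyDeriv hL hp μ a b) univ := by
  intro μ hμ
  have h := analyticOnNhd_cauchySol hL hp a b μ hμ
  have h1 := ((op hL.le hp).analyticAt _).fun_comp h
  have h2 := ((prim hL.le).analyticAt _).fun_comp h
  exact analyticAt_const.add (h1.sub (analyticAt_id.smul h2))

lemma hasSecondDeriv_cauchySol (μ a b : ℂ) :
    HasSecondDeriv L (IccExtend hL.le (cauchySol hL hp μ a b))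
      (fun t => (p t - μ) * IccExtend hL.le (cauchySol hL hp μ a b) t) ∧
      IccExtend hL.le (cauchySol hL hp μ a b) 0 = a ∧
      ∀ x : Icc 0 L, derivWithin (IccExtend hL.le (cauchySol hL hp μ a b)) (Icc 0 L) x =
        cauchyDeriv hL hp μ a b x := by
  have hop : op hL.le (integrableOn_zero (μ := volume) (s := Icc 0 L) (ε' := ℂ)) 1 = 0 := by
    ext x
    simp [op_apply]
  have := hasSecondDeriv_of_volterra hL hp (g := fun _ => 0) integrableOn_zero (μ := μ)
    (a := a) (b := b) (u := cauchySol hL hp μ a b)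
    (by rw [hop, map_zero, sub_zero]; exact sol_eq hL.le hp μ _)
  simp only [hop, sub_zero, ContinuousMap.zero_apply] at this
  exact this

lemma cauchyDeriv_zero (μ a b : ℂ) :
    cauchyDeriv hL hp μ a b ⟨0, ⟨le_rfl, hL.le⟩⟩ = b := by
  rw [cauchyDeriv, ContinuousMap.add_apply, weight_apply hL hp]
  simp

/-- A solution of `f'' = (p - μ) f` is determined by its initial value and slope. -/
lemma HasSecondDeriv.eqOn_cauchySol {μ : ℂ} {f : ℝ → ℂ}
    (hf : HasSecondDeriv L f (fun t => (p t - μ) * f t)) :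
    EqOn f (IccExtend hL.le (cauchySol hL hp μ (f 0) (derivWithin f (Icc 0 L) 0))) (Icc 0 L) := by
  have huI : uIcc 0 L = Icc 0 L := uIcc_of_le hL.le
  have h0 : (0 : ℝ) ∈ Icc 0 L := ⟨le_rfl, hL.le⟩
  have hfc : ContinuousOn f (Icc 0 L) := huI ▸ hf.ac.continuousOn
  have hr : IntegrableOn (fun t => (p t - μ) * f t) (Icc 0 L) :=
    (integrableOn_sub_const hp μ).mul_continuousOn hfc isCompact_Icc
  set u : C(Icc 0 L, ℂ) := ⟨(Icc 0 L).domRestrict f, hfc.domRestrict⟩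
  have hext : EqOn (IccExtend hL.le u) f (Icc 0 L) := fun x hx => by
    rw [IccExtend_of_mem hL.le _ hx]
    rfl
  have hw : ∀ x : Icc 0 L, weight hL.le hp μ u x =
      derivWithin f (Icc 0 L) x - derivWithin f (Icc 0 L) 0 := by
    intro x
    rw [weight_apply hL hp, hf.deriv_eq_integral hL hr x.2, add_sub_cancel_left]
    refine intervalIntegral.integral_congr fun t ht => ?_
    have ht' : t ∈ Icc 0 L := ordConnected_Icc.uIcc_subset h0 x.2 ht
    simp only [hext ht']
  have hu : u = affine L (f 0) (derivWithin f (Icc 0 L) 0) +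
      prim hL.le (weight hL.le hp μ u) := by
    ext x
    rw [ContinuousMap.add_apply, prim_apply]
    change f x = _
    rw [hf.eq_integral hL x.2]
    have : ∫ t in (0 : ℝ)..x, IccExtend hL.le (weight hL.le hp μ u) t =
        ∫ t in (0 : ℝ)..x, (derivWithin f (Icc 0 L) t - derivWithin f (Icc 0 L) 0) := by
      refine intervalIntegral.integral_congr fun t ht => ?_
      have ht' : t ∈ Icc 0 L := ordConnected_Icc.uIcc_subset h0 x.2 ht
      simp only [IccExtend_of_mem hL.le _ ht', hw]
    rw [this, intervalIntegral.integral_sub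
      (hf.ac_deriv.continuousOn.mono (by
        rw [huI]; exact ordConnected_Icc.uIcc_subset h0 x.2)).intervalIntegrable
      intervalIntegrable_const]
    simp only [affine, ContinuousMap.coe_mk, intervalIntegral.integral_const, sub_zero,
      Complex.real_smul]
    ring
  intro x hx
  rw [← hext hx, cauchySol, ← eq_sol hL.le hp hu]

/-- The inhomogeneous equation `f'' = (p - μ) f - g` has a solution. -/
lemma exists_hasSecondDeriv (hL : 0 < L) {p : ℝ → ℂ} (hp : IntegrableOn p (Icc 0 L))
    (μ : ℂ) {g : ℝ → ℂ} (hg : IntegrableOn g (Icc 0 L)) :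
    ∃ f : ℝ → ℂ, HasSecondDeriv L f (fun t => (p t - μ) * f t - g t) :=
  ⟨_, (hasSecondDeriv_of_volterra hL hp hg (a := 0) (b := 0) (sol_eq hL.le hp μ _)).1⟩

end Solution

end SturmLiouville

/-! ### Simple poles and residues -/

section Residue

variable {F : Type*} [NormedAddCommGroup F] [NormedSpace ℂ F]

/-- By Cauchy's formula, `N μ / (μ - z)` has residue `N z` at `z`. -/
lemma hasResidueAt_of_eventuallyEq [CompleteSpace F] {M N : ℂ → F} {z : ℂ}
    (hN : AnalyticAt ℂ N z) (h : M =ᶠ[𝓝[≠] z] fun μ => (μ - z)⁻¹ • N μ) :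
    HasResidueAt M z (N z) := by
  obtain ⟨ε, hε, hball⟩ := Metric.eventually_nhds_iff_ball.1
    ((eventually_nhdsWithin_iff.1 h).and hN.eventually_analyticAt)
  filter_upwards [Ioo_mem_nhdsGT hε] with r hr
  have hsub : Metric.closedBall z r ⊆ Metric.ball z ε := Metric.closedBall_subset_ball hr.2
  have hne : ∀ w ∈ Metric.sphere z r, w ≠ z := fun w hw hwz => by
    rw [hwz, Metric.mem_sphere, dist_self] at hw
    exact hr.1.ne hw
  have heq : EqOn M (fun μ => (μ - z)⁻¹ • N μ) (Metric.sphere z r) := fun w hw =>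
    (hball w (hsub (Metric.sphere_subset_closedBall hw))).1 (hne w hw)
  have hdiff : DifferentiableOn ℂ N (Metric.closedBall z r) := fun w hw =>
    (hball w (hsub hw)).2.differentiableAt.differentiableWithinAt
  constructor
  · refine ContinuousOn.circleIntegrable hr.1.le (ContinuousOn.congr ?_ heq)
    refine ContinuousOn.smul (ContinuousOn.inv₀ (by fun_prop) fun w hw => ?_)
      (hdiff.continuousOn.mono Metric.sphere_subset_closedBall)
    exact sub_ne_zero.2 (hne w hw)
  · rw [circleIntegral.integral_congr hr.1.le heq,
      hdiff.circleIntegral_sub_inv_smul (Metric.mem_ball_self hr.1), smul_smul,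
      inv_mul_cancel₀ Complex.two_pi_I_ne_zero, one_smul]

lemma isSimplePoleAt_of_eventuallyEq {M N : ℂ → F} {z : ℂ}
    (hN : AnalyticAt ℂ N z) (h : M =ᶠ[𝓝[≠] z] fun μ => (μ - z)⁻¹ • N μ)
    (hM : ¬ IsRemovableSingularityAt M z) : IsSimplePoleAt M z := by
  have hmero : MeromorphicAt M z := by
    refine MeromorphicAt.congr ?_ h.symm
    exact (MeromorphicAt.inv (by fun_prop)).smul hN.meromorphicAt
  refine ⟨hmero, ?_⟩
  have := (meromorphicOrderAt_eq_int_iff (n := -1) hmero).2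
  push_cast at this
  refine this ⟨N, hN, fun hz => hM ?_, ?_⟩
  · -- if `N z = 0`, then `N` is divisible by `μ - z` and the singularity is removable
    refine ⟨dslope N z, ?_, ?_⟩
    · obtain ⟨p, hp⟩ := hN
      exact ⟨_, hp.has_fpower_series_dslope_fslope⟩
    · filter_upwards [h, self_mem_nhdsWithin] with w hw hwz
      rw [hw, dslope_of_ne _ hwz, slope_def_module, hz, sub_zero]
  · filter_upwards [h] with w hw
    simpa using hw

/-- A meromorphic function has at most a simple pole, if the leading coefficient of every
putative expansion with a higher order pole vanishes. -/
lemma MeromorphicAt.exists_analyticAt_simple_pole {x : ℂ → F} {z : ℂ} (hx : MeromorphicAt x z)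
    (h : ∀ (n : ℕ) (y : ℂ → F), AnalyticAt ℂ y z →
      (∀ᶠ μ in 𝓝[≠] z, y μ = (μ - z) ^ (n + 2) • x μ) → y z = 0) :
    ∃ y : ℂ → F, AnalyticAt ℂ y z ∧ ∀ᶠ μ in 𝓝[≠] z, y μ = (μ - z) • x μ := by
  by_cases htop : meromorphicOrderAt x z = ⊤
  · refine ⟨0, analyticAt_const, ?_⟩
    filter_upwards [meromorphicOrderAt_eq_top_iff.1 htop] with μ hμ
    simp [hμ]
  obtain ⟨k, hk⟩ := WithTop.ne_top_iff_exists.1 htop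
  obtain ⟨g, hg, hgz, hgx⟩ := (meromorphicOrderAt_eq_int_iff hx).1 hk.symm
  rcases le_or_gt (-1) k with hk1 | hk1
  · obtain ⟨n, hn⟩ := Int.eq_ofNat_of_zero_le (show 0 ≤ k + 1 by lia)
    refine ⟨fun μ => (μ - z) ^ n • g μ, by fun_prop, ?_⟩
    filter_upwards [hgx, self_mem_nhdsWithin] with μ hμ hne
    rw [hμ, smul_smul, ← zpow_one_add₀ (sub_ne_zero.2 hne), add_comm 1 k, hn]
    simp
  · obtain ⟨n, hn⟩ := Int.eq_ofNat_of_zero_le (show 0 ≤ -k - 2 by lia)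
    refine absurd (h n g hg ?_) hgz
    filter_upwards [hgx, self_mem_nhdsWithin] with μ hμ hne
    rw [hμ, smul_smul, ← zpow_natCast, ← zpow_add₀ (sub_ne_zero.2 hne)]
    rw [show ((n + 2 : ℕ) : ℤ) + k = 0 by push_cast; lia, zpow_zero, one_smul]

end Residue

/-! ### Analytic families of linear maps -/

namespace AnalyticFamily

lemma injective_iff_det_ne_zero {ι : Type*} [Fintype ι]
    (T : (ι → ℂ) →ₗ[ℂ] (ι → ℂ)) :
    Function.Injective T ↔ T.det ≠ 0 := by
  rw [← isUnit_iff_ne_zero, ← LinearMap.isUnit_iff_isUnit_det, LinearMap.isUnit_iff_ker_eq_bot,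
    LinearMap.ker_eq_bot]

variable {ι : Type*} [Fintype ι] [DecidableEq ι] {D : ℂ → (ι → ℂ) →ₗ[ℂ] (ι → ℂ)}

lemma analyticAt_det_matrix {A : ℂ → Matrix ι ι ℂ} {z : ℂ}
    (hA : ∀ i j, AnalyticAt ℂ (fun μ => A μ i j) z) : AnalyticAt ℂ (fun μ => (A μ).det) z := by
  simp only [Matrix.det_apply']
  refine Finset.analyticAt_fun_sum _ fun σ _ => ?_
  exact analyticAt_const.mul (Finset.analyticAt_fun_prod _ fun i _ => hA _ _)

lemma analyticAt_toMatrix (hD : ∀ x i, AnalyticOnNhd ℂ (fun μ => D μ x i) univ)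
    (z : ℂ) (i j : ι) :
    AnalyticAt ℂ (fun μ => LinearMap.toMatrix' (D μ) i j) z := by
  simp only [LinearMap.toMatrix'_apply]
  exact hD _ i z (mem_univ _)

lemma analyticOnNhd_det (hD : ∀ x i, AnalyticOnNhd ℂ (fun μ => D μ x i) univ) :
    AnalyticOnNhd ℂ (fun μ => (D μ).det) univ := by
  intro z _
  simp only [← LinearMap.det_toMatrix']
  exact analyticAt_det_matrix (analyticAt_toMatrix hD z)

/-- The points where an analytic family of linear maps fails to be injective are isolated, unless
they are all points. -/
lemma eventually_injective (hD : ∀ x i, AnalyticOnNhd ℂ (fun μ => D μ x i) univ)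
    {z₀ : ℂ} (h0 : Function.Injective (D z₀)) (z : ℂ) :
    ∀ᶠ μ in 𝓝[≠] z, Function.Injective (D μ) := by
  simp only [injective_iff_det_ne_zero] at h0 ⊢
  by_contra hcon
  have := (analyticOnNhd_det hD).eqOn_zero_of_preconnected_of_frequently_eq_zero
    isPreconnected_univ (mem_univ z) ((not_eventually.1 hcon).mono fun μ => not_not.1)
  exact h0 (this (mem_univ z₀))

lemma eventually_injective_nhds (hD : ∀ x i, AnalyticOnNhd ℂ (fun μ => D μ x i) univ)
    {z : ℂ} (hz : Function.Injective (D z)) :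
    ∀ᶠ μ in 𝓝 z, Function.Injective (D μ) := by
  simp only [injective_iff_det_ne_zero] at hz ⊢
  exact ((analyticOnNhd_det hD) z (mem_univ z)).continuousAt.eventually_ne hz

/-- Cramer's rule: off the zeros of the determinant, `D μ x = b` is solved by a quotient of entire
functions. -/
lemma exists_analytic_solution (hD : ∀ x i, AnalyticOnNhd ℂ (fun μ => D μ x i) univ)
    (b : ι → ℂ) : ∃ y : ℂ → ι → ℂ, AnalyticOnNhd ℂ y univ ∧
    ∀ μ, Function.Injective (D μ) → D μ ((D μ).det⁻¹ • y μ) = b := by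
  refine ⟨fun μ => (LinearMap.toMatrix' (D μ)).cramer b, fun z _ => ?_, fun μ hμ => ?_⟩
  · refine analyticAt_pi_iff.2 fun i => ?_
    simp only [Matrix.cramer_apply]
    refine analyticAt_det_matrix fun j k => ?_
    by_cases hk : k = i
    · simp only [hk, Matrix.updateCol_self]
      exact analyticAt_const
    · simp only [Matrix.updateCol_ne hk]
      exact analyticAt_toMatrix hD z j k
  · have h := Matrix.mulVec_cramer (LinearMap.toMatrix' (D μ)) b
    rw [LinearMap.toMatrix'_mulVec, LinearMap.det_toMatrix'] at h
    rw [map_smul, h, smul_smul, inv_mul_cancel₀ ((injective_iff_det_ne_zero _).1 hμ), one_smul]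

lemma continuousAt_apply (hD : ∀ x i, AnalyticOnNhd ℂ (fun μ => D μ x i) univ)
    {y : ℂ → ι → ℂ} {z : ℂ} (hy : ContinuousAt y z) :
    ContinuousAt (fun μ => D μ (y μ)) z := by
  have h : (fun μ => D μ (y μ)) = fun μ => ∑ j, y μ j • D μ (Pi.single j 1) := by
    funext μ
    conv_lhs => rw [← Finset.univ_sum_single (y μ), map_sum]
    refine Finset.sum_congr rfl fun j _ => ?_
    rw [← map_smul, ← Pi.single_smul', smul_eq_mul, mul_one]
  rw [h]
  refine tendsto_finsetSum _ fun j _ => ?_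
  refine ((continuousAt_pi.1 hy) j).smul (continuousAt_pi.2 fun i => ?_)
  exact (hD _ i z (mem_univ z)).continuousAt

end AnalyticFamily

/-! ### Functions on a metric graph -/

namespace MetricGraph

open SturmLiouville

section Basic

variable {V E : Type*} {G : MetricGraph V E} {q : E → ℝ → ℝ}

lemma isAC2_of_hasSecondDeriv {f r : E → ℝ → ℂ}
    (h : ∀ e, HasSecondDeriv (G.length e) (f e) (r e)) : G.IsAC2 f := fun e =>
  ⟨(h e).differentiableOn, (h e).ac, (h e).ac_deriv⟩

lemma schrodinger_ae_eq {f r : E → ℝ → ℂ} {e : E}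
    (h : HasSecondDeriv (G.length e) (f e) (r e)) :
    G.schrodinger q f e =ᵐ[(volume : Measure ℝ).restrict (G.edge e)]
      fun t => -r e t + (q e t : ℂ) * f e t := by
  filter_upwards [h.ae_eq] with x hx
  simp only [schrodinger, ← hx]
  rfl

lemma IsAC2.hasSecondDeriv {f : E → ℝ → ℂ} (hf : G.IsAC2 f) {e : E} {F : ℝ → ℂ}
    (hF : G.schrodinger q f e =ᵐ[(volume : Measure ℝ).restrict (G.edge e)] F) :
    HasSecondDeriv (G.length e) (f e) (fun t => (q e t : ℂ) * f e t - F t) := by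
  refine ⟨(hf e).1, (hf e).2.1, (hf e).2.2, ?_⟩
  filter_upwards [hF] with x hx
  rw [← hx]
  simp only [schrodinger, deriv2, deriv, edge]
  ring

lemma isContinuous_of_vertex {f : E → ℝ → ℂ} {φ : V → ℂ}
    (hf : ∀ e, ContinuousOn (f e) (G.edge e)) (h0 : ∀ e, f e 0 = φ (G.origin e))
    (hl : ∀ e, f e (G.length e) = φ (G.terminus e)) : G.IsContinuous f :=
  ⟨hf, fun e e' h => by rw [h0, h0, h], fun e e' h => by rw [h0, hl, h],
    fun e e' h => by rw [hl, hl, h]⟩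

lemma vertexValue_eq {f : E → ℝ → ℂ} {φ : V → ℂ} (h0 : ∀ e, f e 0 = φ (G.origin e))
    (hl : ∀ e, f e (G.length e) = φ (G.terminus e)) (v : V) : G.vertexValue f v = φ v := by
  unfold vertexValue
  split_ifs with h1 h2
  · rw [h0, h1.choose_spec]
  · rw [hl, h2.choose_spec]
  · exact absurd (G.endpoint_surj v) (not_or.2 ⟨h1, h2⟩)

lemma isContinuous_zero : G.IsContinuous (0 : E → ℝ → ℂ) :=
  ⟨fun _ => continuousOn_const, fun _ _ _ => rfl, fun _ _ _ => rfl, fun _ _ _ => rfl⟩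

lemma IsContinuous.apply_zero {f : E → ℝ → ℂ} (hf : G.IsContinuous f) (e : E) :
    f e 0 = G.vertexValue f (G.origin e) := by
  have h : ∃ e', G.origin e' = G.origin e := ⟨e, rfl⟩
  rw [vertexValue, dif_pos h]
  exact hf.origin_origin _ _ h.choose_spec.symm

lemma IsContinuous.apply_length {f : E → ℝ → ℂ} (hf : G.IsContinuous f) (e : E) :
    f e (G.length e) = G.vertexValue f (G.terminus e) := by
  unfold vertexValue
  split_ifs with h1 h2
  · exact (hf.origin_terminus _ _ h1.choose_spec).symm
  · exact hf.terminus_terminus _ _ h2.choose_spec.symm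
  · exact absurd ⟨e, rfl⟩ h2

lemma sum_normalDeriv_mul [Fintype V] [Fintype E] (f : E → ℝ → ℂ) (c : V → ℂ) :
    ∑ v, G.normalDeriv f v * c v =
      ∑ e, (G.deriv f e (G.length e) * c (G.terminus e) - G.deriv f e 0 * c (G.origin e)) := by
  classical
  simp only [normalDeriv, sub_mul, Finset.sum_sub_distrib, Finset.sum_mul, Finset.sum_filter]
  congr 1 <;> rw [Finset.sum_comm] <;> simp

lemma conj_sum_normalDeriv [Fintype V] [Fintype E] (f : E → ℝ → ℂ) (c : V → ℂ) :
    ∑ v, c v * conj (G.normalDeriv f v) =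
      ∑ e, (c (G.terminus e) * conj (G.deriv f e (G.length e)) -
        c (G.origin e) * conj (G.deriv f e 0)) := by
  have h := congrArg conj (sum_normalDeriv_mul (G := G) f fun v => conj (c v))
  simpa only [map_sum, map_sub, map_mul, Complex.conj_conj, mul_comm] using h

/-- The sesquilinear form `∑ₑ ∫ₑ f ḡ`. -/
noncomputable def pairing (G : MetricGraph V E) [Fintype E] (f g : E → ℝ → ℂ) : ℂ :=
  ∑ e, ∫ t in (0 : ℝ)..G.length e, f e t * conj (g e t)

/-- Lagrange's identity on a metric graph: the operator `𝓛` is symmetric up to the boundary data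
at the vertices. -/
lemma lagrange [Fintype V] [Fintype E] {α : V → ℝ} (hq : ∀ e, IntegrableOn (q e) (G.edge e))
    {f g F H : E → ℝ → ℂ} (hf : G.IsAC2 f) (hfc : G.IsContinuous f) (hg : G.IsAC2 g)
    (hgc : G.IsContinuous g) (hF : ∀ e, IntegrableOn (F e) (G.edge e))
    (hH : ∀ e, IntegrableOn (H e) (G.edge e))
    (hfF : ∀ e, G.schrodinger q f e =ᵐ[(volume : Measure ℝ).restrict (G.edge e)] F e)
    (hgH : ∀ e, G.schrodinger q g e =ᵐ[(volume : Measure ℝ).restrict (G.edge e)] H e) :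
    G.pairing F g - G.pairing f H = ∑ v, (G.vertexValue f v * conj (G.deltaData α g v) -
      G.deltaData α f v * conj (G.vertexValue g v)) := by
  have hedge : ∀ e, (∫ t in (0 : ℝ)..G.length e, F e t * conj (g e t)) -
      (∫ t in (0 : ℝ)..G.length e, f e t * conj (H e t)) =
      (f e (G.length e) * conj (G.deriv g e (G.length e)) - f e 0 * conj (G.deriv g e 0)) -
      (G.deriv f e (G.length e) * conj (g e (G.length e)) - G.deriv f e 0 * conj (g e 0)) := by
    intro e
    have hL := G.length_pos e
    have hsub : uIcc 0 (G.length e) = G.edge e := uIcc_eq_edge e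
    have hii : ∀ {k : ℝ → ℂ}, IntegrableOn k (G.edge e) →
        IntervalIntegrable k volume 0 (G.length e) := fun hk =>
      (hk.mono_set hsub.subset).intervalIntegrable
    have hqc : IntegrableOn (fun t => (q e t : ℂ)) (G.edge e) := (hq e).ofReal
    have hint : ∀ {k K : ℝ → ℂ}, ContinuousOn k (G.edge e) → IntegrableOn K (G.edge e) →
        IntegrableOn (fun t => (q e t : ℂ) * k t - K t) (G.edge e) := fun hk hK =>
      Integrable.sub (hqc.mul_continuousOn hk isCompact_Icc) hK
    have hHc : IntegrableOn (fun t => conj (H e t)) (G.edge e) :=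
      Complex.conjLIE.integrable_comp_iff.2 (hH e)
    have hgs : ContinuousOn (fun t => conj (g e t)) (uIcc 0 (G.length e)) := by
      rw [hsub]
      exact Complex.continuous_conj.comp_continuousOn (hgc.continuousOn e)
    have h := (hf.hasSecondDeriv (hfF e)).lagrange hL (hint (hfc.continuousOn e) (hF e))
      (hg.hasSecondDeriv (hgH e)) (hint (hgc.continuousOn e) (hH e))
    -- `f'' conj g - f conj g''` is `-(F conj g - f conj H)`: the `q` terms cancel, as `q` is real
    rw [← intervalIntegral.integral_sub ((hii (hF e)).mul_continuousOn hgs)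
      ((hii hHc).continuousOn_mul (by rw [hsub]; exact hfc.continuousOn e)),
      ← neg_inj, ← intervalIntegral.integral_neg]
    refine Eq.trans (intervalIntegral.integral_congr fun t _ => ?_) (h.trans ?_)
    · simp only [map_sub, map_mul, Complex.conj_ofReal]
      ring
    · simp only [deriv, edge]
      ring
  -- the terms with `α` cancel, because `α` is real
  have hsum : ∑ v, (G.vertexValue f v * conj (G.deltaData α g v) -
      G.deltaData α f v * conj (G.vertexValue g v)) =
      ∑ v, G.vertexValue f v * conj (G.normalDeriv g v) -
      ∑ v, G.normalDeriv f v * conj (G.vertexValue g v) := by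
    rw [← Finset.sum_sub_distrib]
    refine Finset.sum_congr rfl fun v _ => ?_
    simp only [deltaData, map_sub, map_mul, Complex.conj_ofReal]
    ring
  rw [hsum, conj_sum_normalDeriv, sum_normalDeriv_mul, pairing, pairing,
    ← Finset.sum_sub_distrib, ← Finset.sum_sub_distrib]
  refine Finset.sum_congr rfl fun e _ => ?_
  rw [hedge, hfc.apply_zero, hfc.apply_length, hgc.apply_zero, hgc.apply_length]

/-! ### Representatives and the operator -/

lemma inner_eq_pairing [Fintype E] {u w : G.L2} {f g : E → ℝ → ℂ} (hu : G.IsRep u f)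
    (hw : G.IsRep w g) : inner ℂ w u = G.pairing f g := by
  rw [PiLp.inner_apply, pairing]
  refine Finset.sum_congr rfl fun e _ => ?_
  rw [L2.inner_def, intervalIntegral.integral_of_le (G.length_pos e).le,
    ← integral_Icc_eq_integral_Ioc]
  refine integral_congr_ae ?_
  filter_upwards [hu e, hw e] with x h1 h2
  rw [h1, h2, RCLike.inner_apply]

lemma exists_isRep [Fintype E] {f : E → ℝ → ℂ}
    (hf : ∀ e, MemLp (f e) 2 ((volume : Measure ℝ).restrict (G.edge e))) :
    ∃ u : G.L2, G.IsRep u f :=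
  ⟨WithLp.toLp 2 fun e => (hf e).toLp _, fun e => (hf e).coeFn_toLp⟩

lemma memLp_of_continuousOn {f : ℝ → ℂ} {e : E} (hf : ContinuousOn f (G.edge e)) :
    MemLp f 2 ((volume : Measure ℝ).restrict (G.edge e)) := by
  have : IsFiniteMeasure ((volume : Measure ℝ).restrict (G.edge e)) :=
    ⟨by simp [edge]⟩
  obtain ⟨C, hC⟩ := isCompact_Icc.exists_bound_of_continuousOn hf
  refine MemLp.of_bound (hf.aestronglyMeasurable measurableSet_Icc) C ?_
  filter_upwards [ae_restrict_mem (measurableSet_Icc : MeasurableSet (G.edge e))] with x hx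
  exact hC x hx

lemma integrableOn_of_memLp {f : ℝ → ℂ} {e : E}
    (hf : MemLp f 2 ((volume : Measure ℝ).restrict (G.edge e))) : IntegrableOn f (G.edge e) := by
  have : IsFiniteMeasure ((volume : Measure ℝ).restrict (G.edge e)) :=
    ⟨by simp [edge]⟩
  exact hf.integrable one_le_two

lemma isRep_unique [Fintype E] {u w : G.L2} {f : E → ℝ → ℂ} (hu : G.IsRep u f)
    (hw : G.IsRep w f) : u = w := by
  ext1 e
  exact Lp.ext ((hu e).trans (hw e).symm)

lemma eqOn_zero_of_pairing_self [Fintype E] {f : E → ℝ → ℂ} (hf : G.IsContinuous f)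
    (h : G.pairing f f = 0) (e : E) : EqOn (f e) 0 (G.edge e) := by
  obtain ⟨u, hu⟩ := exists_isRep (G := G) fun e => memLp_of_continuousOn (hf.continuousOn e)
  rw [← inner_eq_pairing hu hu, inner_self_eq_zero] at h
  subst h
  exact hu.eqOn isRep_zero hf isContinuous_zero e

variable [Fintype E] {α : V → ℝ}

lemma isRep_operator (u : (G.operator q α).domain) :
    G.IsRep (G.operator q α u) (G.schrodinger q (G.rep (q := q) (α := α) u)) := fun e =>
  ((G.isDomainFun_rep (q := q) (α := α) u).memLp e).coeFn_toLp

/-- The operator acts by `𝓛` on any representative that satisfies the domain conditions. -/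
lemma exists_operator_apply {u : G.L2} {f : E → ℝ → ℂ} (hu : G.IsRep u f)
    (hf : G.IsDomainFun q α f) : ∃ h : u ∈ (G.operator q α).domain,
      G.IsRep (G.operator q α ⟨u, h⟩) (G.schrodinger q f) := by
  have h : u ∈ (G.operator q α).domain := ⟨f, hu, hf⟩
  refine ⟨h, fun e => (isRep_operator ⟨u, h⟩ e).trans ?_⟩
  filter_upwards [ae_restrict_mem (measurableSet_Icc : MeasurableSet (G.edge e))] with x hx
  exact schrodinger_congr (G.rep_eqOn hu hf.continuous) q e hx

/-- The operator `A_α` is symmetric. -/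
lemma operator_symmetric [Fintype V] (hq : ∀ e, IntegrableOn (q e) (G.edge e))
    (u w : (G.operator q α).domain) :
    inner ℂ (w : G.L2) (G.operator q α u) = inner ℂ (G.operator q α w) (u : G.L2) := by
  have hu := G.isDomainFun_rep (q := q) (α := α) u
  have hw := G.isDomainFun_rep (q := q) (α := α) w
  rw [inner_eq_pairing (isRep_operator u) (G.isRep_rep (q := q) (α := α) w),
    inner_eq_pairing (G.isRep_rep (q := q) (α := α) u) (isRep_operator w), ← sub_eq_zero,
    lagrange (α := α) hq hu.ac2 hu.continuous hw.ac2 hw.continuous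
      (fun e => integrableOn_of_memLp (hu.memLp e)) (fun e => integrableOn_of_memLp (hw.memLp e))
      (fun _ => ae_eq_rfl) (fun _ => ae_eq_rfl)]
  simp [hu.delta, hw.delta]

/-- `f` is a function on the graph which lies in `AC²`, is continuous, and solves `𝓛 f = μ f`; no
condition is imposed on the normal derivatives. -/
structure IsSolution (G : MetricGraph V E) (q : E → ℝ → ℝ) (μ : ℂ) (f : E → ℝ → ℂ) : Prop where
  ac2 : G.IsAC2 f
  continuous : G.IsContinuous f
  equation : ∀ e, G.schrodinger q f e =ᵐ[(volume : Measure ℝ).restrict (G.edge e)]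
    fun x => μ * f e x

lemma IsSolution.isDomainFun {μ : ℂ} {f : E → ℝ → ℂ} (hf : G.IsSolution q μ f)
    (h : ∀ v, G.deltaData α f v = 0) : G.IsDomainFun q α f :=
  ⟨hf.ac2, hf.continuous, fun e => ((memLp_of_continuousOn
    (hf.continuous.continuousOn e)).const_mul μ).ae_eq (hf.equation e).symm, h⟩

/-- Lagrange's identity for two solutions, possibly for different spectral parameters. -/
lemma IsSolution.lagrange [Fintype V] (hq : ∀ e, IntegrableOn (q e) (G.edge e)) {μ ν : ℂ}
    {f g : E → ℝ → ℂ} (hf : G.IsSolution q μ f) (hg : G.IsSolution q ν g) :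
    (μ - conj ν) * G.pairing f g = ∑ v, (G.vertexValue f v * conj (G.deltaData α g v) -
      G.deltaData α f v * conj (G.vertexValue g v)) := by
  have hint : ∀ {h : E → ℝ → ℂ} (c : ℂ), G.IsContinuous h → ∀ e,
      IntegrableOn (fun x => c * h e x) (G.edge e) := fun c hh e =>
    integrableOn_of_memLp ((memLp_of_continuousOn (hh.continuousOn e)).const_mul c)
  rw [← MetricGraph.lagrange (α := α) hq hf.ac2 hf.continuous hg.ac2 hg.continuous
    (F := fun e x => μ * f e x) (H := fun e x => ν * g e x) (hint μ hf.continuous)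
    (hint ν hg.continuous) hf.equation hg.equation]
  simp only [pairing]
  rw [sub_mul]
  simp only [Finset.mul_sum, ← intervalIntegral.integral_const_mul, map_mul, mul_assoc,
    mul_left_comm (conj ν)]

lemma isSolution_rep {μ : ℂ} (u : (G.operator q α).eigenKer μ) :
    G.IsSolution q μ (G.rep (q := q) (α := α) u.1) := by
  have hu := G.isDomainFun_rep (q := q) (α := α) u.1
  refine ⟨hu.ac2, hu.continuous, fun e => ?_⟩
  have h1 : G.operator q α u.1 = μ • (u.1 : G.L2) := sub_eq_zero.1 u.2
  have h2 := (G.isRep_rep (q := q) (α := α) u.1).smul μ e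
  have h3 := isRep_operator u.1 e
  rw [h1] at h3
  exact h3.symm.trans h2

/-- Solutions of `𝓛 f = μ f` that satisfy the vertex conditions represent elements of
`ker (A_α - μ)`. -/
lemma IsSolution.exists_eigenKer {μ : ℂ} {f : E → ℝ → ℂ} (hf : G.IsSolution q μ f)
    (h : ∀ v, G.deltaData α f v = 0) : ∃ u : (G.operator q α).eigenKer μ,
      G.IsRep (u.1 : G.L2) f ∧ ∀ e, EqOn (G.rep (q := q) (α := α) u.1 e) (f e) (G.edge e) := by
  obtain ⟨u, hu⟩ := exists_isRep (G := G) fun e =>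
    memLp_of_continuousOn (hf.continuous.continuousOn e)
  obtain ⟨hdom, hop⟩ := exists_operator_apply hu (hf.isDomainFun h)
  refine ⟨⟨⟨u, hdom⟩, ?_⟩, hu, fun e => G.rep_eqOn (u := ⟨u, hdom⟩) hu hf.continuous e⟩
  refine sub_eq_zero.2 (isRep_unique hop fun e => ?_)
  exact ((hu.smul μ) e).trans (hf.equation e).symm

end Basic

end MetricGraph

/-! ### The characteristic map -/

namespace MetricGraph

open SturmLiouville

section Characteristic

variable {V E : Type*} {G : MetricGraph V E} {q : E → ℝ → ℝ}

lemma integrableOn_ofReal (hq : ∀ e, IntegrableOn (q e) (G.edge e)) (e : E) :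
    IntegrableOn (fun t => (q e t : ℂ)) (Icc 0 (G.length e)) := (hq e).ofReal

/-- The function on the graph whose component on each edge `e` solves `-f'' + q f = μ f`, with
`f 0 = x (inl (inl e))` and `f' 0 = x (inl (inr e))`. The coordinates `x (inr v)` play no role
here; in the characteristic map they stand for the values at the vertices. -/
noncomputable def glue (hq : ∀ e, IntegrableOn (q e) (G.edge e)) (μ : ℂ)
    (x : (E ⊕ E) ⊕ V → ℂ) (e : E) : ℝ → ℂ :=
  IccExtend (G.length_pos e).le (cauchySol (G.length_pos e) (integrableOn_ofReal hq e) μ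
    (x (.inl (.inl e))) (x (.inl (.inr e))))

/-- The endpoint `L_e` as an element of the interval `[0, L_e]`. -/
def endpoint (G : MetricGraph V E) (e : E) : Icc 0 (G.length e) :=
  ⟨G.length e, length_mem_edge e⟩

lemma vertexValue_zero (v : V) : G.vertexValue (0 : E → ℝ → ℂ) v = 0 := by
  simp [vertexValue]

variable (hq : ∀ e, IntegrableOn (q e) (G.edge e)) (μ : ℂ) (x : (E ⊕ E) ⊕ V → ℂ)

lemma glue_zero (e : E) : glue hq μ x e 0 = x (.inl (.inl e)) :=
  (hasSecondDeriv_cauchySol _ _ _ _ _).2.1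

lemma glue_length (e : E) : glue hq μ x e (G.length e) =
    cauchySol (G.length_pos e) (integrableOn_ofReal hq e) μ
      (x (.inl (.inl e))) (x (.inl (.inr e))) (G.endpoint e) :=
  IccExtend_of_mem _ _ (length_mem_edge e)

lemma deriv_glue_zero (e : E) : G.deriv (glue hq μ x) e 0 = x (.inl (.inr e)) := by
  have h := (hasSecondDeriv_cauchySol (G.length_pos e) (integrableOn_ofReal hq e) μ
    (x (.inl (.inl e))) (x (.inl (.inr e)))).2.2 ⟨0, zero_mem_edge e⟩
  rw [cauchyDeriv_zero] at h
  exact h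

lemma deriv_glue_length (e : E) : G.deriv (glue hq μ x) e (G.length e) =
    cauchyDeriv (G.length_pos e) (integrableOn_ofReal hq e) μ
      (x (.inl (.inl e))) (x (.inl (.inr e))) (G.endpoint e) :=
  (hasSecondDeriv_cauchySol (G.length_pos e) (integrableOn_ofReal hq e) μ
    (x (.inl (.inl e))) (x (.inl (.inr e)))).2.2 (G.endpoint e)

lemma hasSecondDeriv_glue (e : E) : HasSecondDeriv (G.length e) (glue hq μ x e)
    (fun t => ((q e t : ℂ) - μ) * glue hq μ x e t) :=
  (hasSecondDeriv_cauchySol _ _ _ _ _).1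

lemma continuousOn_glue (e : E) : ContinuousOn (glue hq μ x e) (G.edge e) :=
  ((ContinuousMap.continuous _).Icc_extend' (h := (G.length_pos e).le)).continuousOn

lemma schrodinger_glue (e : E) :
    G.schrodinger q (glue hq μ x) e =ᵐ[(volume : Measure ℝ).restrict (G.edge e)]
      fun t => μ * glue hq μ x e t :=
  (schrodinger_ae_eq (r := fun e t => ((q e t : ℂ) - μ) * glue hq μ x e t)
    (hasSecondDeriv_glue hq μ x e)).trans (ae_of_all _ fun t => by ring)

variable [Fintype E]

open Classical in
/-- The characteristic map at `μ`. Its argument consists of initial values and initial slopes of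
solutions on the edges and of prospective values at the vertices. Its first two components say by
how much these solutions fail to attain the vertex values at the two ends of each edge, the third
one is the boundary expression `∂_ν f(v) - α_v f(v)`. -/
noncomputable def charMap (α : V → ℝ) : ((E ⊕ E) ⊕ V → ℂ) →ₗ[ℂ] ((E ⊕ E) ⊕ V → ℂ) where
  toFun x := Sum.elim (Sum.elim (fun e => x (.inl (.inl e)) - x (.inr (G.origin e)))
      (fun e => cauchySol (G.length_pos e) (integrableOn_ofReal hq e) μ
        (x (.inl (.inl e))) (x (.inl (.inr e))) (G.endpoint e) - x (.inr (G.terminus e))))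
    (fun v => (∑ e with G.terminus e = v, cauchyDeriv (G.length_pos e) (integrableOn_ofReal hq e) μ
        (x (.inl (.inl e))) (x (.inl (.inr e))) (G.endpoint e)) -
      (∑ e with G.origin e = v, x (.inl (.inr e))) - (α v : ℂ) * x (.inr v))
  map_add' x y := by
    ext i
    rcases i with (e | e) | v
    · simp only [Sum.elim_inl, Pi.add_apply]
      ring
    · simp only [Sum.elim_inl, Sum.elim_inr, Pi.add_apply, cauchySol_add, ContinuousMap.add_apply]
      ring
    · simp only [Sum.elim_inr, Pi.add_apply, cauchyDeriv_add, ContinuousMap.add_apply,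
        Finset.sum_add_distrib]
      ring
  map_smul' c x := by
    ext i
    rcases i with (e | e) | v
    · simp only [Sum.elim_inl, Pi.smul_apply, smul_eq_mul, RingHom.id_apply]
      ring
    · simp only [Sum.elim_inl, Sum.elim_inr, Pi.smul_apply, smul_eq_mul, cauchySol_smul,
        ContinuousMap.smul_apply, RingHom.id_apply]
      ring
    · simp only [Sum.elim_inr, Pi.smul_apply, smul_eq_mul, cauchyDeriv_smul,
        ContinuousMap.smul_apply, RingHom.id_apply, ← Finset.mul_sum]
      ring

variable (α : V → ℝ)

lemma charMap_origin (e : E) : charMap hq μ α x (.inl (.inl e)) =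
    glue hq μ x e 0 - x (.inr (G.origin e)) := by
  rw [glue_zero]
  rfl

lemma charMap_terminus (e : E) : charMap hq μ α x (.inl (.inr e)) =
    glue hq μ x e (G.length e) - x (.inr (G.terminus e)) := by
  rw [glue_length]
  rfl

lemma charMap_vertex (v : V) : charMap hq μ α x (.inr v) =
    G.normalDeriv (glue hq μ x) v - (α v : ℂ) * x (.inr v) := by
  simp only [normalDeriv, deriv_glue_length, deriv_glue_zero]
  rfl

lemma analyticOnNhd_charMap (i : (E ⊕ E) ⊕ V) :
    AnalyticOnNhd ℂ (fun μ => charMap hq μ α x i) univ := by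
  intro μ hμ
  have heval : ∀ e, AnalyticOnNhd ℂ (fun u : C(Icc 0 (G.length e), ℂ) => u (G.endpoint e)) univ :=
    fun e => ContinuousLinearMap.analyticOnNhd
      (ContinuousMap.evalCLM ℂ (G.endpoint e) : C(Icc 0 (G.length e), ℂ) →L[ℂ] ℂ) univ
  rcases i with (e | e) | v
  · exact analyticAt_const
  · exact ((heval e _ (mem_univ _)).fun_comp
      (analyticOnNhd_cauchySol (G.length_pos e) (integrableOn_ofReal hq e) _ _ μ hμ)).sub
      analyticAt_const
  · refine ((Finset.analyticAt_fun_sum _ fun e _ => ?_).sub analyticAt_const).sub analyticAt_const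
    exact (heval e _ (mem_univ _)).fun_comp
      (analyticOnNhd_cauchyDeriv (G.length_pos e) (integrableOn_ofReal hq e) _ _ μ hμ)

variable {μ x α}

lemma vertexValue_glue (hx : ∀ i, charMap hq μ α x (.inl i) = 0) (v : V) :
    G.vertexValue (glue hq μ x) v = x (.inr v) :=
  vertexValue_eq (φ := fun v => x (.inr v))
    (fun e => sub_eq_zero.1 ((charMap_origin hq μ x α e).symm.trans (hx (.inl e))))
    (fun e => sub_eq_zero.1 ((charMap_terminus hq μ x α e).symm.trans (hx (.inr e)))) v

lemma isSolution_glue (hx : ∀ i, charMap hq μ α x (.inl i) = 0) :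
    G.IsSolution q μ (glue hq μ x) :=
  ⟨isAC2_of_hasSecondDeriv (hasSecondDeriv_glue hq μ x),
    isContinuous_of_vertex (φ := fun v => x (.inr v)) (continuousOn_glue hq μ x)
      (fun e => sub_eq_zero.1 ((charMap_origin hq μ x α e).symm.trans (hx (.inl e))))
      (fun e => sub_eq_zero.1 ((charMap_terminus hq μ x α e).symm.trans (hx (.inr e)))),
    schrodinger_glue hq μ x⟩

lemma deltaData_glue (hx : ∀ i, charMap hq μ α x (.inl i) = 0) (v : V) :
    G.deltaData α (glue hq μ x) v = charMap hq μ α x (.inr v) := by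
  rw [deltaData, vertexValue_glue hq hx, charMap_vertex]

/-- The coordinates can be recovered from the function on the graph. -/
lemma eq_zero_of_glue (hx : ∀ i, charMap hq μ α x (.inl i) = 0)
    (h : ∀ e, EqOn (glue hq μ x e) 0 (G.edge e)) : x = 0 := by
  ext i
  rcases i with (e | e) | v
  · rw [← glue_zero hq μ x, h e (zero_mem_edge e)]
    rfl
  · rw [← deriv_glue_zero hq μ x, deriv_congr (g := 0) h e (zero_mem_edge e)]
    exact congrFun (derivWithin_const (G.edge e) (0 : ℂ)) 0
  · rw [← vertexValue_glue hq hx, vertexValue_congr (g := 0) h, vertexValue_zero]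
    rfl

lemma deltaData_congr {f g : E → ℝ → ℂ} (h : ∀ e, EqOn (f e) (g e) (G.edge e)) (v : V) :
    G.deltaData α f v = G.deltaData α g v := by
  simp only [deltaData, normalDeriv, vertexValue_congr h, deriv_congr h _ (zero_mem_edge _),
    deriv_congr h _ (length_mem_edge _)]

/-- Every solution of `𝓛 f = μ f` comes from a vector of coordinates. -/
lemma IsSolution.exists_glue {f : E → ℝ → ℂ} (hf : G.IsSolution q μ f) :
    ∃ x, (∀ e, EqOn (f e) (glue hq μ x e) (G.edge e)) ∧
      (∀ i, charMap hq μ α x (.inl i) = 0) ∧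
      ∀ v, charMap hq μ α x (.inr v) = G.deltaData α f v := by
  set x : (E ⊕ E) ⊕ V → ℂ := Sum.elim (Sum.elim (fun e => f e 0) (fun e => G.deriv f e 0))
    (G.vertexValue f) with hxdef
  have heq : ∀ e, EqOn (f e) (glue hq μ x e) (G.edge e) := by
    intro e
    refine HasSecondDeriv.eqOn_cauchySol (G.length_pos e) (integrableOn_ofReal hq e) ?_
    have := hf.ac2.hasSecondDeriv (hf.equation e)
    simpa only [← sub_mul] using this
  have hx : ∀ i, charMap hq μ α x (.inl i) = 0 := by
    rintro (e | e)
    · rw [charMap_origin, ← heq e (zero_mem_edge e), hf.continuous.apply_zero]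
      exact sub_self _
    · rw [charMap_terminus, ← heq e (length_mem_edge e), hf.continuous.apply_length]
      exact sub_self _
  exact ⟨x, heq, hx, fun v => by rw [← deltaData_glue hq hx, deltaData_congr heq]⟩

lemma injective_charMap_of_mem_resolventSet (h : μ ∈ (G.operator q α).resolventSet) :
    Function.Injective (charMap hq μ α) := by
  rw [injective_iff_map_eq_zero]
  intro x hx
  have hx' : ∀ i, charMap hq μ α x (.inl i) = 0 := fun i => congrFun hx _
  have hsol := isSolution_glue hq hx'
  obtain ⟨u, hu, -⟩ := hsol.exists_eigenKer (α := α) fun v => by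
    rw [deltaData_glue hq hx', hx]
    rfl
  obtain ⟨R, -, hR⟩ := h
  have h0 : (u.1 : G.L2) = 0 := by
    have h2 : G.operator q α u.1 - μ • (u.1 : G.L2) = 0 := u.2
    rw [← hR u.1, h2, map_zero]
  rw [h0] at hu
  exact eq_zero_of_glue hq hx' fun e => hu.eqOn isRep_zero hsol.continuous isContinuous_zero e

/-- A solution that satisfies the vertex conditions vanishes, if the characteristic map is
injective. -/
lemma IsSolution.eqOn_zero (hinj : Function.Injective (charMap hq μ α)) {f : E → ℝ → ℂ}
    (hf : G.IsSolution q μ f) (hδ : ∀ v, G.deltaData α f v = 0) (e : E) :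
    EqOn (f e) 0 (G.edge e) := by
  obtain ⟨x, hfx, hx, hv⟩ := hf.exists_glue hq (α := α)
  have : charMap hq μ α x = 0 := by
    ext i
    rcases i with i | v
    · exact hx i
    · rw [hv, hδ]
      rfl
  rw [(map_eq_zero_iff _ hinj).1 this] at hfx
  intro t ht
  rw [hfx e ht]
  simp [glue, cauchySol_zero, IccExtend]

lemma eigenKer_eq_bot (hinj : Function.Injective (charMap hq μ α)) :
    (G.operator q α).eigenKer μ = ⊥ := by
  rw [eq_bot_iff]
  intro u hu
  rw [Submodule.mem_bot]
  have hsol := isSolution_rep (⟨u, hu⟩ : (G.operator q α).eigenKer μ)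
  have h0 := hsol.eqOn_zero hq hinj (G.isDomainFun_rep (q := q) (α := α) u).delta
  refine Subtype.ext (isRep_unique (fun e => ?_) isRep_zero)
  refine (G.isRep_rep (q := q) (α := α) u e).trans ?_
  filter_upwards [ae_restrict_mem (measurableSet_Icc : MeasurableSet (G.edge e))] with t ht
  exact h0 e ht

variable [Fintype V]

/-- The characteristic map is injective off the real axis, since `A_α` is symmetric. -/
lemma injective_charMap_of_conj_ne (hμ : conj μ ≠ μ) :
    Function.Injective (charMap hq μ α) := by
  rw [injective_iff_map_eq_zero]
  intro x hx
  have hx' : ∀ i, charMap hq μ α x (.inl i) = 0 := fun i => congrFun hx _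
  have hsol := isSolution_glue hq hx'
  have h := hsol.lagrange hq hsol (α := α)
  have hδ : ∀ v, G.deltaData α (glue hq μ x) v = 0 := fun v => by
    rw [deltaData_glue hq hx', hx]
    rfl
  simp only [hδ, map_zero, mul_zero, zero_mul, sub_zero, Finset.sum_const_zero] at h
  refine eq_zero_of_glue hq hx' (eqOn_zero_of_pairing_self hsol.continuous ?_)
  exact (mul_eq_zero.1 h).resolve_left (sub_ne_zero.2 hμ.symm)

/-- The set of points where the characteristic map is injective is symmetric about the real axis. -/
lemma injective_charMap_conj (h : Function.Injective (charMap hq μ α)) :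
    Function.Injective (charMap hq (conj μ) α) := by
  by_cases hμ : conj μ = μ
  · rwa [hμ]
  · exact injective_charMap_of_conj_ne hq (by rwa [Complex.conj_conj, ne_comm])

/-! ### Spectrum and resolvent -/

/-- Where the characteristic map is injective, `A_α - μ` is surjective: a solution of the
inhomogeneous equation on the edges is corrected by a solution of the homogeneous one. -/
lemma exists_operator_sub_smul_eq (hinj : Function.Injective (charMap hq μ α)) (g : G.L2) :
    ∃ u : (G.operator q α).domain, G.operator q α u - μ • (u : G.L2) = g := by
  have hgint : ∀ e, IntegrableOn (g e) (G.edge e) := fun e => integrableOn_of_memLp (Lp.memLp _)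
  choose p hp using fun e =>
    exists_hasSecondDeriv (G.length_pos e) (integrableOn_ofReal hq e) μ (hgint e)
  have hpac : G.IsAC2 p := isAC2_of_hasSecondDeriv hp
  obtain ⟨x, hx⟩ := (LinearMap.injective_iff_surjective.1 hinj)
    (Sum.elim (Sum.elim (fun e => -p e 0) (fun e => -p e (G.length e)))
      (fun v => -G.normalDeriv p v))
  set f := p + glue hq μ x with hf
  have hgac : G.IsAC2 (glue hq μ x) := isAC2_of_hasSecondDeriv (hasSecondDeriv_glue hq μ x)
  have hfac : G.IsAC2 f := hpac.add hgac
  have hpc : ∀ e, ContinuousOn (p e) (G.edge e) := fun e => by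
    have := (hp e).ac.continuousOn
    rwa [uIcc_eq_edge] at this
  have h0 : ∀ e, f e 0 = x (.inr (G.origin e)) := fun e => by
    have := charMap_origin hq μ x α e
    rw [hx] at this
    simp only [Sum.elim_inl] at this
    simp only [hf, Pi.add_apply]
    linear_combination -this
  have hl : ∀ e, f e (G.length e) = x (.inr (G.terminus e)) := fun e => by
    have := charMap_terminus hq μ x α e
    rw [hx] at this
    simp only [Sum.elim_inl, Sum.elim_inr] at this
    simp only [hf, Pi.add_apply]
    linear_combination -this
  have hfc : G.IsContinuous f := isContinuous_of_vertex (φ := fun v => x (.inr v))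
    (fun e => (hpc e).add (continuousOn_glue hq μ x e)) h0 hl
  have hδ : ∀ v, G.deltaData α f v = 0 := fun v => by
    have h1 : G.normalDeriv f v = G.normalDeriv p v + G.normalDeriv (glue hq μ x) v := by
      simp only [normalDeriv, hf, deriv_add hpac hgac _ (zero_mem_edge _),
        deriv_add hpac hgac _ (length_mem_edge _), Pi.add_apply, Finset.sum_add_distrib]
      ring
    have h2 := charMap_vertex hq μ x α v
    rw [hx] at h2
    simp only [Sum.elim_inr] at h2
    rw [deltaData, vertexValue_eq (φ := fun v => x (.inr v)) h0 hl, h1]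
    linear_combination -h2
  have hschr : ∀ e, G.schrodinger q f e =ᵐ[(volume : Measure ℝ).restrict (G.edge e)]
      fun t => μ * f e t + g e t := fun e => by
    filter_upwards [schrodinger_add q hpac hgac e, schrodinger_glue hq μ x e,
      schrodinger_ae_eq (q := q) (r := fun e t => ((q e t : ℂ) - μ) * p e t - g e t) (hp e)]
      with t h1 h2 h3
    rw [h1, Pi.add_apply, h2, h3]
    simp only [hf, Pi.add_apply]
    ring
  obtain ⟨u, hu⟩ := exists_isRep (G := G) fun e => memLp_of_continuousOn (hfc.continuousOn e)
  have hdom : G.IsDomainFun q α f := ⟨hfac, hfc, fun e =>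
    (((memLp_of_continuousOn (hfc.continuousOn e)).const_mul μ).add (Lp.memLp (g e))).ae_eq
      (hschr e).symm, hδ⟩
  obtain ⟨hmem, hop⟩ := exists_operator_apply hu hdom
  refine ⟨⟨u, hmem⟩, sub_eq_iff_eq_add'.2 (isRep_unique hop fun e => ?_)⟩
  have hg : G.IsRep g (fun e => g e) := fun e => ae_eq_rfl
  exact (((hu.smul μ).add hg) e).trans (hschr e).symm

/-- Where the characteristic map is injective, `A_α - μ` has a bounded inverse. Boundedness follows
from the closed graph theorem and the symmetry of `A_α`. -/
lemma mem_resolventSet (hinj : Function.Injective (charMap hq μ α)) :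
    μ ∈ (G.operator q α).resolventSet := by
  have hinj' := injective_charMap_conj hq hinj
  let T : ℂ → (G.operator q α).domain →ₗ[ℂ] G.L2 := fun ν =>
    (G.operator q α).toFun - ν • (G.operator q α).domain.subtype
  let Φ : (G.operator q α).domain ≃ₗ[ℂ] G.L2 := LinearEquiv.ofBijective (T μ)
    ⟨LinearMap.ker_eq_bot.1 (eigenKer_eq_bot hq hinj), exists_operator_sub_smul_eq hq hinj⟩
  let R : G.L2 →ₗ[ℂ] G.L2 := (G.operator q α).domain.subtype ∘ₗ Φ.symm.toLinearMap
  have hRT : ∀ g, G.operator q α (Φ.symm g) - μ • R g = g := fun g => Φ.apply_symm_apply g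
  -- the adjoint of `R` is the inverse of `A_α - conj μ`, which is everywhere defined as well
  have hadj : ∀ g (w : (G.operator q α).domain),
      inner ℂ (T (conj μ) w) (R g) = inner ℂ (w : G.L2) g := by
    intro g w
    conv_rhs => rw [← hRT g]
    rw [inner_sub_right, operator_symmetric hq, inner_smul_right]
    change inner ℂ (G.operator q α w - conj μ • (w : G.L2)) (R g) = _
    rw [inner_sub_left, inner_smul_left, Complex.conj_conj]
    rfl
  have hcont : Continuous R := by
    refine R.continuous_of_seq_closed_graph fun s g h hs hRs => ?_
    rw [← sub_eq_zero, ← inner_self_eq_zero (𝕜 := ℂ)]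
    obtain ⟨w, hw⟩ := exists_operator_sub_smul_eq hq hinj' (h - R g)
    have hw' : T (conj μ) w = h - R g := hw
    have h1 : Tendsto (fun n => inner ℂ (T (conj μ) w) (R (s n))) atTop
        (𝓝 (inner ℂ (T (conj μ) w) h)) := tendsto_const_nhds.inner hRs
    have h2 : Tendsto (fun n => inner ℂ (T (conj μ) w) (R (s n))) atTop
        (𝓝 (inner ℂ (T (conj μ) w) (R g))) := by
      simp only [hadj]
      exact tendsto_const_nhds.inner hs
    rw [inner_sub_right, ← hw', tendsto_nhds_unique h1 h2, sub_self]
  refine ⟨⟨R, hcont⟩, fun g => ⟨(Φ.symm g).2, hRT g⟩, fun f => ?_⟩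
  exact congrArg Subtype.val (Φ.symm_apply_apply f)

/-- The spectrum of `A_α` consists of the points where the characteristic map is singular. -/
lemma notMem_spectrum_iff :
    μ ∉ (G.operator q α).spectrum ↔ Function.Injective (charMap hq μ α) :=
  not_not.trans ⟨injective_charMap_of_mem_resolventSet hq, mem_resolventSet hq⟩

end Characteristic

end MetricGraph

/-! ### Gram matrices -/

/-- A matrix `R` of the form `-γ γ*` has the same range as `γ`. Here `γ*` is given by the
vectors `-u l` that represent the functionals `w ↦ γ w l`, and `R k l = γ (u l) k`. -/
lemma LinearMap.range_eq_range_mulVecLin {K ι : Type*} [NormedAddCommGroup K]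
    [InnerProductSpace ℂ K] [FiniteDimensional ℂ K] [Fintype ι] (γ : K →ₗ[ℂ] ι → ℂ)
    {R : Matrix ι ι ℂ} (u : ι → K) (hR : ∀ k l, γ (u l) k = R k l)
    (hu : ∀ w l, inner ℂ w (u l) = -conj (γ w l)) :
    LinearMap.range γ = LinearMap.range R.mulVecLin := by
  have hmul : ∀ c : ι → ℂ, R.mulVecLin c = γ (∑ l, c l • u l) := fun c => by
    ext k
    simp only [Matrix.mulVecLin_apply, Matrix.mulVec, dotProduct, map_sum, map_smul,
      Finset.sum_apply, Pi.smul_apply, smul_eq_mul, hR, mul_comm]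
  let γ' : K →ₗ[ℂ] EuclideanSpace ℂ ι := (WithLp.linearEquiv 2 ℂ (ι → ℂ)).symm.toLinearMap ∘ₗ γ
  have hadj : ∀ c : EuclideanSpace ℂ ι, LinearMap.adjoint γ' c = -∑ l, c l • u l := fun c => by
    refine ext_inner_left ℂ fun w => ?_
    rw [LinearMap.adjoint_inner_right, inner_neg_right, inner_sum, PiLp.inner_apply,
      ← Finset.sum_neg_distrib]
    refine Finset.sum_congr rfl fun l _ => ?_
    rw [inner_smul_right, hu, RCLike.inner_apply]
    change c l * conj (γ w l) = _
    ring
  apply le_antisymm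
  · rintro _ ⟨w, rfl⟩
    have hw : γ' w ∈ LinearMap.range (γ' ∘ₗ LinearMap.adjoint γ') := by
      rw [LinearMap.range_self_comp_adjoint]
      exact ⟨w, rfl⟩
    obtain ⟨c, hc⟩ := hw
    refine ⟨fun l => -c l, ?_⟩
    rw [LinearMap.comp_apply, hadj] at hc
    rw [hmul, ← (WithLp.linearEquiv 2 ℂ (ι → ℂ)).symm.injective hc]
    simp only [neg_smul, Finset.sum_neg_distrib]
  · rintro _ ⟨c, rfl⟩
    exact ⟨_, (hmul c).symm⟩

namespace MetricGraph

open SturmLiouville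

/-! ### Weyl solutions -/

section Weyl

variable {V E : Type*} {G : MetricGraph V E} {q : E → ℝ → ℝ} [Fintype E]
  (hq : ∀ e, IntegrableOn (q e) (G.edge e)) {μ : ℂ} {x : (E ⊕ E) ⊕ V → ℂ} {α : V → ℝ}

open Classical in
/-- The right-hand side of the characteristic system for the Weyl solution at the vertex `v`. -/
noncomputable def unitData (E : Type*) {V : Type*} (v : V) : (E ⊕ E) ⊕ V → ℂ :=
  Sum.elim 0 fun w => if w = v then 1 else 0

/-- Weyl solutions at `v` correspond to the coordinates that the characteristic map sends to
`unitData E v`. -/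
lemma isWeylSolution_glue {v : V} (hx : charMap hq μ α x = unitData E v) :
    G.IsWeylSolution q α μ v (glue hq μ x) := by
  have hx' : ∀ i, charMap hq μ α x (.inl i) = 0 := fun i => congrFun hx _
  have h := isSolution_glue hq hx'
  exact ⟨h.ac2, h.continuous, h.equation, fun w => by rw [deltaData_glue hq hx', hx]; rfl⟩

lemma IsWeylSolution.eqOn_glue (hinj : Function.Injective (charMap hq μ α)) {v : V}
    (hx : charMap hq μ α x = unitData E v) {g : E → ℝ → ℂ} (hg : G.IsWeylSolution q α μ v g)
    (e : E) : EqOn (g e) (glue hq μ x e) (G.edge e) := by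
  obtain ⟨y, hgy, hy, hyv⟩ := IsSolution.exists_glue hq (α := α)
    ⟨hg.ac2, hg.continuous, hg.equation⟩
  have hxy : x = y := by
    refine hinj (hx.trans ?_)
    ext i
    rcases i with i | w
    · exact (hy i).symm
    · rw [hyv, hg.data]
      rfl
  rw [hxy]
  exact hgy e

lemma titchmarshWeyl_eq (hinj : Function.Injective (charMap hq μ α)) {B : Finset V} {k l : B}
    (hx : charMap hq μ α x = unitData E (l : V)) :
    G.titchmarshWeyl q α B μ k l = x (.inr k) := by
  have h : ∃ f, G.IsWeylSolution q α μ l f := ⟨_, isWeylSolution_glue hq hx⟩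
  rw [titchmarshWeyl, Matrix.of_apply, dif_pos h,
    vertexValue_congr (h.choose_spec.eqOn_glue hq hinj hx),
    vertexValue_glue hq fun i => congrFun hx _]

/-- `ker (A_α - μ)` is finite-dimensional, since its elements are determined by their initial values
and slopes on the edges. -/
lemma finiteDimensional_eigenKer (hq : ∀ e, IntegrableOn (q e) (G.edge e)) (α : V → ℝ) (μ : ℂ) :
    FiniteDimensional ℂ ((G.operator q α).eigenKer μ) := by
  let ρ : (G.operator q α).domain → E → ℝ → ℂ := fun u => G.rep (q := q) (α := α) u
  have hρ : ∀ u, G.IsDomainFun q α (ρ u) := fun u => G.isDomainFun_rep (q := q) (α := α) u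
  have hadd : ∀ u w e, EqOn (ρ (u + w) e) ((ρ u + ρ w) e) (G.edge e) := fun u w =>
    G.rep_add (q := q) (α := α) u w
  have hsmul : ∀ (c : ℂ) u e, EqOn (ρ (c • u) e) ((c • ρ u) e) (G.edge e) := fun c u =>
    G.rep_smul (q := q) (α := α) c u
  let Λ : (G.operator q α).domain →ₗ[ℂ] (E → ℂ) × (E → ℂ) :=
    { toFun := fun u => (fun e => ρ u e 0, fun e => G.deriv (ρ u) e 0)
      map_add' := fun u w => by
        refine Prod.ext (funext fun e => hadd u w e (zero_mem_edge e)) (funext fun e => ?_)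
        exact (deriv_congr (hadd u w) e (zero_mem_edge e)).trans
          (deriv_add (hρ u).ac2 (hρ w).ac2 e (zero_mem_edge e))
      map_smul' := fun c u => by
        refine Prod.ext (funext fun e => hsmul c u e (zero_mem_edge e)) (funext fun e => ?_)
        exact (deriv_congr (hsmul c u) e (zero_mem_edge e)).trans
          (deriv_smul c (hρ u).ac2 e (zero_mem_edge e)) }
  refine FiniteDimensional.of_injective (Λ.domRestrict ((G.operator q α).eigenKer μ)) ?_
  rw [injective_iff_map_eq_zero]
  intro u hu
  obtain ⟨x, hx, hx0, -⟩ := (isSolution_rep u).exists_glue hq (α := α)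
  have ha : ∀ e, x (.inl (.inl e)) = 0 := fun e => by
    rw [← glue_zero hq μ x, ← hx e (zero_mem_edge e)]
    exact congrFun (congrArg Prod.fst hu) e
  have hb : ∀ e, x (.inl (.inr e)) = 0 := fun e => by
    rw [← deriv_glue_zero hq μ x, ← deriv_congr hx e (zero_mem_edge e)]
    exact congrFun (congrArg Prod.snd hu) e
  refine Subtype.ext (Subtype.ext (isRep_unique (fun e => ?_) isRep_zero))
  refine (G.isRep_rep (q := q) (α := α) u.1 e).trans ?_
  filter_upwards [ae_restrict_mem (measurableSet_Icc : MeasurableSet (G.edge e))] with s hs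
  rw [hx e hs, glue, ha, hb, cauchySol_zero]
  rfl

lemma continuousAt_pairing_glue {y : ℂ → (E ⊕ E) ⊕ V → ℂ} {z : ℂ} (hy : ContinuousAt y z)
    {g : E → ℝ → ℂ} (hg : G.IsContinuous g) :
    ContinuousAt (fun μ => G.pairing (glue hq μ (y μ)) g) z := by
  refine tendsto_finsetSum _ fun e _ => ?_
  have hL := G.length_pos e
  have hp := integrableOn_ofReal hq e
  have hgi : IntegrableOn (fun t => conj (g e t)) (Icc 0 (G.length e)) :=
    (Complex.continuous_conj.comp_continuousOn (hg.continuousOn e)).integrableOn_Icc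
  have hsol : ContinuousAt (fun μ => cauchySol hL hp μ (y μ (.inl (.inl e)))
      (y μ (.inl (.inr e)))) z := by
    have heq : ∀ μ, cauchySol hL hp μ (y μ (.inl (.inl e))) (y μ (.inl (.inr e))) =
        y μ (.inl (.inl e)) • cauchySol hL hp μ 1 0 +
          y μ (.inl (.inr e)) • cauchySol hL hp μ 0 1 := fun μ => by
      rw [← cauchySol_smul, ← cauchySol_smul, ← cauchySol_add]
      simp
    simp only [heq]
    exact ((continuousAt_pi.1 hy _).smul
      (analyticOnNhd_cauchySol hL hp 1 0 z (mem_univ z)).continuousAt).add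
      ((continuousAt_pi.1 hy _).smul
        (analyticOnNhd_cauchySol hL hp 0 1 z (mem_univ z)).continuousAt)
  have hcont : Continuous fun u : C(Icc 0 (G.length e), ℂ) =>
      Volterra.op hL.le hgi u (G.endpoint e) :=
    (continuous_eval_const _).comp (Volterra.op hL.le hgi).continuous
  have := hcont.continuousAt.comp hsol
  simpa only [ContinuousAt, Function.comp_def, Volterra.op_apply, glue, endpoint, mul_comm]
    using this

variable [Fintype V]

/-- The coordinates of the Weyl solution at `v` are quotients of entire functions. -/
lemma exists_analytic_weyl (hq : ∀ e, IntegrableOn (q e) (G.edge e)) (α : V → ℝ) (v : V) :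
    ∃ (y : ℂ → (E ⊕ E) ⊕ V → ℂ) (d : ℂ → ℂ), AnalyticOnNhd ℂ y univ ∧ AnalyticOnNhd ℂ d univ ∧
      ∀ μ, Function.Injective (charMap hq μ α) →
        d μ ≠ 0 ∧ charMap hq μ α ((d μ)⁻¹ • y μ) = unitData E v := by
  classical
  have hD : ∀ x i, AnalyticOnNhd ℂ (fun μ => charMap hq μ α x i) univ := fun x i =>
    analyticOnNhd_charMap hq x α i
  obtain ⟨y, hy, hyD⟩ := AnalyticFamily.exists_analytic_solution hD (unitData E v)
  exact ⟨y, fun μ => (charMap hq μ α).det, hy, AnalyticFamily.analyticOnNhd_det hD,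
    fun μ hμ => ⟨(AnalyticFamily.injective_iff_det_ne_zero _).1 hμ, hyD μ hμ⟩⟩

lemma eventually_injective_charMap (z : ℂ) :
    ∀ᶠ μ in 𝓝[≠] z, Function.Injective (charMap hq μ α) := by
  classical
  refine AnalyticFamily.eventually_injective (fun x i => analyticOnNhd_charMap hq x α i)
    (z₀ := Complex.I) (injective_charMap_of_conj_ne hq ?_) z
  rw [Complex.conj_I]
  exact neg_ne_self.2 Complex.I_ne_zero

lemma analyticAt_titchmarshWeyl (B : Finset V) {z : ℂ}
    (hz : Function.Injective (charMap hq z α)) : AnalyticAt ℂ (G.titchmarshWeyl q α B) z := by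
  classical
  choose y d hy hd hyd using fun l : B => exists_analytic_weyl hq α (l : V)
  have hN : AnalyticAt ℂ (fun μ (k l : B) => ((d l μ)⁻¹ • y l μ) (.inr (k : V))) z := by
    refine analyticAt_pi_iff.2 fun k => analyticAt_pi_iff.2 fun l => ?_
    have h1 := (hd l z (mem_univ z)).inv (hyd l z hz).1
    exact h1.mul (analyticAt_pi_iff.1 (hy l z (mem_univ z)) _)
  refine AnalyticAt.congr (f := fun μ (k l : B) => ((d l μ)⁻¹ • y l μ) (.inr (k : V))) hN ?_
  filter_upwards [AnalyticFamily.eventually_injective_nhds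
    (fun x i => analyticOnNhd_charMap hq x α i) hz] with μ hμ
  ext k l
  exact (titchmarshWeyl_eq hq hμ (hyd l μ hμ).2).symm

/-! ### The principal part at an eigenvalue -/

/-- If `μ ↦ y μ` is a continuous family of coordinates whose boundary data are `(μ - t) ^ (n + 1)`
times those of a Weyl solution, then its value at `t` is an eigenfunction, and Lagrange's identity
determines the inner products of that eigenfunction with all eigenfunctions. -/
lemma pairing_glue_of_eventually {t : ℝ} {n : ℕ} {v : V} {y : ℂ → (E ⊕ E) ⊕ V → ℂ}
    (hy : ContinuousAt y t)
    (h : ∀ᶠ μ in 𝓝[≠] (t : ℂ), charMap hq μ α (y μ) = (μ - t) ^ (n + 1) • unitData E v) :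
    charMap hq (t : ℂ) α (y t) = 0 ∧ ∀ g, G.IsSolution q t g → (∀ w, G.deltaData α g w = 0) →
      G.pairing (glue hq t (y t)) g = -((0 : ℂ) ^ n * conj (G.vertexValue g v)) := by
  classical
  constructor
  · have h1 := (AnalyticFamily.continuousAt_apply
      (fun x i => analyticOnNhd_charMap hq x α i) hy).tendsto.mono_left
      (nhdsWithin_le_nhds (s := {(t : ℂ)}ᶜ))
    have h2 : Tendsto (fun μ : ℂ => (μ - t) ^ (n + 1) • unitData E v) (𝓝[≠] (t : ℂ)) (𝓝 0) := by
      have : ContinuousAt (fun μ : ℂ => (μ - t) ^ (n + 1) • unitData E v) t := by fun_prop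
      have := this.tendsto.mono_left (nhdsWithin_le_nhds (s := {(t : ℂ)}ᶜ))
      simpa using this
    exact tendsto_nhds_unique h1 (h2.congr' (h.mono fun μ hμ => hμ.symm))
  · intro g hg hδ
    have h1 := (continuousAt_pairing_glue hq hy hg.continuous).tendsto.mono_left
      (nhdsWithin_le_nhds (s := {(t : ℂ)}ᶜ))
    have h2 : Tendsto (fun μ : ℂ => -((μ - t) ^ n * conj (G.vertexValue g v))) (𝓝[≠] (t : ℂ))
        (𝓝 (-((0 : ℂ) ^ n * conj (G.vertexValue g v)))) := by
      have : ContinuousAt (fun μ : ℂ => -((μ - t) ^ n * conj (G.vertexValue g v))) t := by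
        fun_prop
      have := this.tendsto.mono_left (nhdsWithin_le_nhds (s := {(t : ℂ)}ᶜ))
      simpa using this
    refine tendsto_nhds_unique h1 (h2.congr' ?_)
    filter_upwards [h, self_mem_nhdsWithin] with μ hμ hne
    have hx : ∀ i, charMap hq μ α (y μ) (.inl i) = 0 := fun i => by
      rw [hμ]
      simp [unitData]
    have hl := (isSolution_glue hq hx).lagrange hq hg (α := α)
    simp only [hδ, map_zero, mul_zero, zero_sub, deltaData_glue hq hx, hμ, Complex.conj_ofReal,
      Finset.sum_neg_distrib] at hl
    have hs : ∑ w, ((μ - t) ^ (n + 1) • unitData E v) (.inr w) * conj (G.vertexValue g w) =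
        (μ - t) ^ (n + 1) * conj (G.vertexValue g v) := by
      simp [unitData]
    rw [hs] at hl
    refine mul_left_cancel₀ (sub_ne_zero.2 (hne : μ ≠ t)) ?_
    rw [hl]
    ring

/-- The coordinates of the Weyl solutions have at most simple poles on the real axis: the leading
coefficient of a higher order pole would be an eigenfunction orthogonal to all eigenfunctions. -/
lemma exists_principal_part (t : ℝ) (v : V) : ∃ y : ℂ → (E ⊕ E) ⊕ V → ℂ, AnalyticAt ℂ y t ∧
    ∀ᶠ μ in 𝓝[≠] (t : ℂ), charMap hq μ α (y μ) = (μ - t) • unitData E v := by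
  obtain ⟨y₀, d, hy₀, hd, hyd⟩ := exists_analytic_weyl hq α v
  have hinj := eventually_injective_charMap hq (α := α) (t : ℂ)
  have hmero : MeromorphicAt (fun μ => (d μ)⁻¹ • y₀ μ) (t : ℂ) :=
    (hd t (mem_univ _)).meromorphicAt.inv.smul (hy₀ t (mem_univ _)).meromorphicAt
  obtain ⟨y, hy, hyx⟩ := hmero.exists_analyticAt_simple_pole fun n y hy hyx => by
    obtain ⟨hker, hpair⟩ := pairing_glue_of_eventually hq (α := α) (n := n + 1) (v := v)
      hy.continuousAt (by
        filter_upwards [hyx, hinj] with μ h1 h2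
        rw [h1, map_smul, (hyd μ h2).2])
    have hx : ∀ i, charMap hq (t : ℂ) α (y t) (.inl i) = 0 := fun i => congrFun hker _
    have hsol := isSolution_glue hq hx
    refine eq_zero_of_glue hq hx (eqOn_zero_of_pairing_self hsol.continuous ?_)
    rw [hpair _ hsol fun w => by rw [deltaData_glue hq hx, hker]; rfl]
    simp
  refine ⟨y, hy, ?_⟩
  filter_upwards [hyx, hinj] with μ h1 h2
  rw [h1, map_smul, (hyd μ h2).2]

end Weyl

end MetricGraph

theorem mainTheorem3 {V E : Type*} [Fintype V] [Fintype E] (G : MetricGraph V E)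
    (q : E → ℝ → ℝ) (hq : ∀ e, IntegrableOn (q e) (G.edge e))
    (α : V → ℝ) (B : Finset V) (hB : B.Nonempty) :
    -- the defining boundary value problem of the Titchmarsh–Weyl function is well posed
    (∀ μ ∉ (G.operator q α).spectrum, ∀ l : B,
      ∃ f, G.IsWeylSolution q α μ l f ∧
        (∀ g, G.IsWeylSolution q α μ l g → ∀ e, EqOn (g e) (f e) (G.edge e)) ∧
        ∀ k : B, G.titchmarshWeyl q α B μ k l = G.vertexValue f k) ∧
    -- analyticity off the spectrum
    AnalyticOnNhd ℂ (G.titchmarshWeyl q α B) (G.operator q α).spectrumᶜ ∧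
    -- the singularities are isolated, and each of them is removable or a simple pole
    (∀ z ∈ (G.operator q α).spectrum,
      (∀ᶠ μ in 𝓝[≠] z, μ ∉ (G.operator q α).spectrum) ∧
      (¬ IsRemovableSingularityAt (G.titchmarshWeyl q α B) z →
        IsSimplePoleAt (G.titchmarshWeyl q α B) z)) ∧
    -- the residues
    (∀ t : ℝ, ∃ R : Matrix B B ℂ,
      HasResidueAt (G.titchmarshWeyl q α B) t R ∧
      LinearMap.range (G.gamma q α B t) = LinearMap.range R.mulVecLin ∧
      FiniteDimensional ℂ ((G.operator q α).eigenKer t) ∧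
      Module.finrank ℂ ((G.operator q α).eigenKer t) =
        R.rank + Module.finrank ℂ (LinearMap.ker (G.gamma q α B t))) := by
  have hspec : ∀ {μ : ℂ}, μ ∉ (G.operator q α).spectrum →
      Function.Injective (MetricGraph.charMap hq μ α) := (MetricGraph.notMem_spectrum_iff hq).1
  choose y hy hyt using fun (t : ℝ) (l : B) =>
    MetricGraph.exists_principal_part hq (α := α) t (l : V)
  have hN : ∀ t : ℝ, AnalyticAt ℂ
      (fun μ => (Matrix.of fun k l => y t l μ (.inr k) : Matrix B B ℂ)) t := fun t =>
    (analyticAt_pi_iff.2 fun k => analyticAt_pi_iff.2 fun l => analyticAt_pi_iff.1 (hy t l) _ :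
      AnalyticAt ℂ (fun μ (k l : B) => y t l μ (.inr (k : V))) t)
  -- `y t l` is `μ - t` times the coordinate vector of the Weyl solution at `l`
  have hM : ∀ t : ℝ, G.titchmarshWeyl q α B =ᶠ[𝓝[≠] (t : ℂ)] fun μ =>
      (μ - t)⁻¹ • (Matrix.of fun k l => y t l μ (.inr k) : Matrix B B ℂ) := fun t => by
    filter_upwards [eventually_all.2 (hyt t), self_mem_nhdsWithin,
      MetricGraph.eventually_injective_charMap hq (α := α) (t : ℂ)] with μ h1 hne hinj
    ext k l
    refine (MetricGraph.titchmarshWeyl_eq hq hinj (x := (μ - t)⁻¹ • y t l μ) ?_).trans rfl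
    rw [map_smul, h1, smul_smul, inv_mul_cancel₀ (sub_ne_zero.2 hne), one_smul]
  refine ⟨fun μ hμ l => ?_, fun μ hμ => ?_, fun z hz => ⟨?_, ?_⟩, fun t => ?_⟩
  · have hinj := hspec hμ
    obtain ⟨x, hx⟩ := LinearMap.injective_iff_surjective.1 hinj (MetricGraph.unitData E (l : V))
    refine ⟨_, MetricGraph.isWeylSolution_glue hq hx, fun g hg => hg.eqOn_glue hq hinj hx,
      fun k => ?_⟩
    rw [MetricGraph.titchmarshWeyl_eq hq hinj hx,
      MetricGraph.vertexValue_glue hq fun i => congrFun hx _]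
  · exact MetricGraph.analyticAt_titchmarshWeyl hq B (hspec hμ)
  · filter_upwards [MetricGraph.eventually_injective_charMap hq (α := α) z] with μ hμ
    exact (MetricGraph.notMem_spectrum_iff hq).2 hμ
  · -- the spectrum is real
    have hreal : conj z = z := by
      by_contra hne
      exact (MetricGraph.notMem_spectrum_iff hq).2
        (MetricGraph.injective_charMap_of_conj_ne hq hne) hz
    obtain ⟨t, rfl⟩ := Complex.conj_eq_iff_real.1 hreal
    exact isSimplePoleAt_of_eventuallyEq (hN t) (hM t)
  · have hfin := MetricGraph.finiteDimensional_eigenKer hq α (t : ℂ)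
    -- at `t` itself, `y t l` describes an eigenfunction, which is `-γ*` of a unit vector
    have hpp := fun l => MetricGraph.pairing_glue_of_eventually hq (α := α) (n := 0)
      (hy t l).continuousAt (by simpa using hyt t l)
    have hx : ∀ l i, MetricGraph.charMap hq (t : ℂ) α (y t l t) (.inl i) = 0 := fun l i =>
      congrFun (hpp l).1 _
    choose u hu hurep using fun l => (MetricGraph.isSolution_glue hq (hx l)).exists_eigenKer
      (α := α) fun w => by
        rw [MetricGraph.deltaData_glue hq (hx l), (hpp l).1]
        rfl
    have hrange : LinearMap.range (G.gamma q α B t) = LinearMap.range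
        (Matrix.of fun k l => y t l t (.inr k) : Matrix B B ℂ).mulVecLin := by
      refine LinearMap.range_eq_range_mulVecLin _ u (fun k l => ?_) (fun w l => ?_)
      · exact (MetricGraph.vertexValue_congr (hurep l) k).trans
          (MetricGraph.vertexValue_glue hq (hx l) k)
      · change inner ℂ (w.1 : G.L2) ((u l).1 : G.L2) = _
        rw [MetricGraph.inner_eq_pairing (hu l) (G.isRep_rep (q := q) (α := α) w.1),
          (hpp l).2 _ (MetricGraph.isSolution_rep w)
            (G.isDomainFun_rep (q := q) (α := α) w.1).delta, pow_zero, one_mul]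
        rfl
    refine ⟨_, hasResidueAt_of_eventuallyEq (hN t) (hM t), hrange, hfin, ?_⟩
    rw [Matrix.rank, ← hrange, LinearMap.finrank_range_add_finrank_ker]
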